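/- Let $\mathcal A$ be a finite von Neumann algebra acting on a separable complex Hilbert space $H$ (finite: if $v\in\mathcal A$ satisfies $v^*v=I$, then $vv^*=I$; equivalently, $I$ is not Murray–von Neumann equivalent in $\mathcal A$ to a proper subprojection). Let $\mathcal A^{pr}$ be the set of orthogonal projections in $\mathcal A$, with its usual order. Let $\mathcal M\subseteq\mathcal A^{pr}$ be a (nonempty) ideal of projections, that is: a) if $p\in\mathcal A^{pr}$, $q\in\mathcal M$ and $p\le q$, then $p\in\mathcal M$; b) if $p,q\in\mathcal M$ and $\|pq\|<1$, then $p\vee q\in\mathcal M$; c) $\sup\{p : p\in\mathcal M\}=I$. Then there is a sequence $(e_n)_{n}$ in $\mathcal M$ with $e_n\nearrow I$, that is, $e_n\le e_{n+1}$ for all $n$, $\sup_n e_n=I$, and $e_n\to I$ in the strong operator topology. -/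

import Mathlib

open Filter Topology

namespace VonNeumannAlgebra

variable {H : Type*} [NormedAddCommGroup H] [InnerProductSpace ℂ H] [CompleteSpace H]

/-- The set of orthogonal projections belonging to a von Neumann algebra. Projections are
compared in the usual (Loewner) order on bounded operators. -/
def projections (A : VonNeumannAlgebra H) : Set (H →L[ℂ] H) :=
  {p | p ∈ A ∧ IsStarProjection p}

/-- Murray–von Neumann equivalence relative to `A`: `p = v* v` and `q = v v*` for some `v ∈ A`. -/
def MvNEquiv (A : VonNeumannAlgebra H) (p q : H →L[ℂ] H) : Prop :=
  ∃ v ∈ A, star v * v = p ∧ v * star v = q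

/-- A projection `e ∈ A` is finite if it is not equivalent to a proper subprojection. -/
def IsFiniteProjection (A : VonNeumannAlgebra H) (e : H →L[ℂ] H) : Prop :=
  e ∈ A.projections ∧ ∀ p ∈ A.projections, p ≤ e → A.MvNEquiv p e → p = e

/-- A von Neumann algebra is finite if its identity is a finite projection. -/
def IsFinite (A : VonNeumannAlgebra H) : Prop :=
  A.IsFiniteProjection 1

/-- The supremum of a set of orthogonal projections: the orthogonal projection onto the closed
linear span of their ranges. -/
noncomputable def projSup (S : Set (H →L[ℂ] H)) : H →L[ℂ] H :=
  (⨆ p ∈ S, LinearMap.range (p : H →ₗ[ℂ] H)).topologicalClosure.starProjection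

/-- Ideals of projections of a von Neumann algebra. Nonemptiness is automatic from
`projSup_eq_one` unless `H` is the zero space. -/
structure IsProjectionIdeal (A : VonNeumannAlgebra H) (M : Set (H →L[ℂ] H)) : Prop where
  subset_projections : M ⊆ A.projections
  nonempty : M.Nonempty
  mem_of_le : ∀ p ∈ A.projections, ∀ q ∈ M, p ≤ q → p ∈ M
  sup_mem : ∀ p ∈ M, ∀ q ∈ M, ‖p * q‖ < 1 → projSup {p, q} ∈ M
  projSup_eq_one : projSup M = 1

/-- `e n ↗ e₀` for a sequence of projections: the sequence is increasing, its supremum is `e₀`,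
and it converges to `e₀` in the strong operator topology. -/
def IncreasesTo (e : ℕ → H →L[ℂ] H) (e₀ : H →L[ℂ] H) : Prop :=
  Monotone e ∧ projSup (Set.range e) = e₀ ∧ ∀ x : H, Tendsto (fun n => e n x) atTop (𝓝 (e₀ x))

end VonNeumannAlgebra

namespace VonNeumannAlgebra

variable {H : Type*} [NormedAddCommGroup H] [InnerProductSpace ℂ H] [CompleteSpace H]

/-! ### Suprema of projections -/

/-! With a faithful normal tracial state `τ` one would choose `f n ∈ M` with `τ (1 - f n)` summable
and take infima of tails. No trace is constructed here. Separability gives a finite faithful sum of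
vector functionals, `weight x`, and its supremum over the unitary orbit, `maxWeight`, replaces the
trace. It is countably subadditive on suprema (`IsFinite.maxWeight_projSup_le_tsum`), because a
unitary moves `p ∨ q - p` under `q`, and it tends to zero along projections decreasing to zero
(`IsFinite.exists_maxWeight_le`).

Finiteness enters through two facts. Every partial isometry of `A` extends to a unitary of `A`
(`IsFinite.exists_unitary_extension`), and a projection subequivalent to every term of a sequence
decreasing to zero is zero (`IsFinite.eq_zero_of_forall_subequiv`). If `maxWeight` did not tend to
zero, conjugates of disjoint blocks of the sequence would have a nonzero upper limit, contradicting
the second fact.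

The ideal need not be closed under suprema of two elements, as the ranges may meet at angle zero.
Cutting `q` down spectrally to the directions at a positive angle to `f` gives elements `f ∨ g n` of
`M` increasing to `f ∨ q` (`exists_truncation`). Hence finite suprema of elements of `M` are
approximated from below by elements of `M`, up to small `maxWeight`
(`IsProjectionIdeal.approx_sup`), and so is `1`. If the errors of the approximants are summable, the
infima of their tails lie in `M` by heredity and increase to `1` by faithfulness. -/

theorem isStarProjection_projSup (S : Set (H →L[ℂ] H)) : IsStarProjection (projSup S) :=
  isStarProjection_starProjection

theorem projSup_apply_eq_self_iff {S : Set (H →L[ℂ] H)} {x : H} :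
    projSup S x = x ↔
      x ∈ (⨆ p ∈ S, LinearMap.range (p : H →ₗ[ℂ] H)).topologicalClosure :=
  Submodule.starProjection_eq_self_iff

theorem range_le_of_mem {E : Type*} [NormedAddCommGroup E] [InnerProductSpace ℂ E]
    {S : Set (E →L[ℂ] E)} {p : E →L[ℂ] E} (hp : p ∈ S) :
    LinearMap.range (p : E →ₗ[ℂ] E) ≤
      (⨆ p ∈ S, LinearMap.range (p : E →ₗ[ℂ] E)).topologicalClosure :=
  (le_iSup₂ (f := fun (p : E →L[ℂ] E) (_ : p ∈ S) => LinearMap.range (p : E →ₗ[ℂ] E)) p hp).trans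
    (Submodule.le_topologicalClosure _)

theorem projSup_mul_of_mem {S : Set (H →L[ℂ] H)} {p : H →L[ℂ] H} (hp : p ∈ S) :
    projSup S * p = p := by
  ext x
  exact projSup_apply_eq_self_iff.2 (range_le_of_mem hp ⟨x, rfl⟩)

/-- The kernel of `X - Y` is closed, so agreement on the ranges passes to their closed span. This
turns lattice arguments about suprema into operator identities. -/
theorem mul_projSup_congr {S : Set (H →L[ℂ] H)} {X Y : H →L[ℂ] H}
    (h : ∀ p ∈ S, X * p = Y * p) : X * projSup S = Y * projSup S := by
  ext x
  have hle : (⨆ p ∈ S, LinearMap.range (p : H →ₗ[ℂ] H)).topologicalClosure ≤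
      LinearMap.ker ((X - Y : H →L[ℂ] H) : H →ₗ[ℂ] H) := by
    refine Submodule.topologicalClosure_minimal _ (iSup₂_le ?_) (X - Y).isClosed_ker
    rintro p hp _ ⟨y, rfl⟩
    have := congr($(h p hp) y)
    simpa [sub_eq_zero] using this
  have : (X - Y) (projSup S x) = 0 := hle (Submodule.starProjection_apply_mem _ x)
  simpa [sub_eq_zero] using this

theorem mul_projSup {S : Set (H →L[ℂ] H)} {r : H →L[ℂ] H} (h : ∀ p ∈ S, r * p = p) :
    r * projSup S = projSup S := by
  simpa using mul_projSup_congr (X := r) (Y := 1) (by simpa using h)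

theorem mul_projSup_eq_zero {S : Set (H →L[ℂ] H)} {r : H →L[ℂ] H} (h : ∀ p ∈ S, r * p = 0) :
    r * projSup S = 0 := by
  simpa using mul_projSup_congr (X := r) (Y := 0) (by simpa using h)

/-- The kernel of `star p` is the orthogonal complement of the range of `p`. The elements of `S` may
be arbitrary operators, so `projSup {S}` also serves as a range projection. -/
theorem projSup_apply_eq_zero {S : Set (H →L[ℂ] H)} {x : H} (h : ∀ p ∈ S, star p x = 0) :
    projSup S x = 0 := by
  have hle : (⨆ p ∈ S, LinearMap.range (p : H →ₗ[ℂ] H)).topologicalClosure ≤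
      LinearMap.ker ((innerSL ℂ x : H →L[ℂ] ℂ) : H →ₗ[ℂ] ℂ) := by
    refine Submodule.topologicalClosure_minimal _ (iSup₂_le ?_)
      (innerSL ℂ x : H →L[ℂ] ℂ).isClosed_ker
    rintro p hp _ ⟨y, rfl⟩
    have : inner ℂ (star p x) y = 0 := by simp [h p hp]
    rw [ContinuousLinearMap.star_eq_adjoint, ContinuousLinearMap.adjoint_inner_left] at this
    simpa using this
  refine (Submodule.starProjection_apply_eq_zero_iff _).2 ?_
  rw [Submodule.mem_orthogonal']
  intro y hy
  simpa using hle hy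

theorem mem_of_forall_commutant {A : VonNeumannAlgebra H} {x : H →L[ℂ] H}
    (h : ∀ a ∈ A.commutant, a * x = x * a) : x ∈ A := by
  rw [← A.commutant_commutant]
  exact mem_commutant_iff.2 h

theorem commutant_mul_comm {A : VonNeumannAlgebra H} {a x : H →L[ℂ] H}
    (ha : a ∈ A.commutant) (hx : x ∈ A) : a * x = x * a :=
  (mem_commutant_iff.1 ha x hx).symm

/-- A projection `p` with `p a p = a p` for all `a` in the commutant belongs to the algebra. -/
theorem mem_of_invariant {A : VonNeumannAlgebra H} {p : H →L[ℂ] H} (hp : IsStarProjection p)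
    (h : ∀ a ∈ A.commutant, p * a * p = a * p) : p ∈ A := by
  refine mem_of_forall_commutant fun a ha => ?_
  have h1 := h a ha
  have h2 := congr(star $(h (star a) (star_mem ha)))
  simp only [star_mul, star_star, hp.isSelfAdjoint.star_eq] at h2
  rw [← h1, mul_assoc, h2]

theorem projSup_mem {A : VonNeumannAlgebra H} {S : Set (H →L[ℂ] H)} (hS : ∀ p ∈ S, p ∈ A) :
    projSup S ∈ A := by
  refine mem_of_invariant (isStarProjection_projSup S) fun a ha => ?_
  refine mul_projSup_congr fun p hp => ?_
  rw [mul_assoc, commutant_mul_comm ha (hS p hp), ← mul_assoc, projSup_mul_of_mem hp]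

theorem exists_eq_starProjection {p : H →L[ℂ] H} (hp : IsStarProjection p) :
    ∃ K : Submodule ℂ H, ∃ _ : K.HasOrthogonalProjection,
      p = K.starProjection ∧ LinearMap.range (p : H →ₗ[ℂ] H) = K := by
  obtain ⟨K, hK, h⟩ := isStarProjection_iff_eq_starProjection.1 hp
  refine ⟨K, hK, h, ?_⟩
  rw [h]
  exact K.range_starProjection

/-- An increasing sequence of projections converges strongly to its supremum. -/
theorem tendsto_projSup {R : ℕ → H →L[ℂ] H} (hR : ∀ n, IsStarProjection (R n))
    (hmono : ∀ n, R (n + 1) * R n = R n) (x : H) :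
    Tendsto (fun n => R n x) atTop (𝓝 (projSup (Set.range R) x)) := by
  choose K hK hRK hrange using fun n => exists_eq_starProjection (hR n)
  have hm : Monotone K := monotone_nat_of_le_succ fun n => by
    rw [← hrange, ← hrange]
    rintro _ ⟨y, rfl⟩
    exact ⟨R n y, congr($(hmono n) y)⟩
  have h1 : (⨆ p ∈ Set.range R, LinearMap.range (p : H →ₗ[ℂ] H)) = ⨆ n, K n := by
    rw [iSup_range]
    exact iSup_congr hrange
  have h2 := Submodule.starProjection_tendsto_closure_iSup K hm x
  have h3 : projSup (Set.range R) = (⨆ n, K n).topologicalClosure.starProjection := by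
    simp only [projSup, h1]
  rw [h3]
  simpa only [hRK] using h2

/-! ### Polar decomposition -/

theorem norm_apply_eq_of_star_mul_self_eq {S T : H →L[ℂ] H} (h : star S * S = star T * T)
    (x : H) : ‖S x‖ = ‖T x‖ := by
  have key : ∀ U : H →L[ℂ] H, inner ℂ ((star U * U) x) x = ((‖U x‖ ^ 2 : ℝ) : ℂ) := by
    intro U
    rw [mul_apply_eq_comp, ContinuousLinearMap.star_eq_adjoint,
      ContinuousLinearMap.adjoint_inner_left, inner_self_eq_norm_sq_to_K]
    simp
  have h1 := key S
  rw [h, key T, Complex.ofReal_inj] at h1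
  exact (pow_left_inj₀ (norm_nonneg _) (norm_nonneg _) two_ne_zero).1 h1.symm

/-- The C*-identity applied to the difference of the two sides. -/
theorem mul_star_mul_self {V : H →L[ℂ] H} (h : IsStarProjection (star V * V)) :
    V * (star V * V) = V := by
  have h1 : star (V - V * (star V * V)) * (V - V * (star V * V)) = 0 := by
    have : star (V - V * (star V * V)) * (V - V * (star V * V)) =
        (1 - star V * V) * (star V * V) * (1 - star V * V) := by
      simp only [star_sub, star_mul, star_star]
      noncomm_ring
    rw [this, h.one_sub_mul_self, zero_mul]
  exact (sub_eq_zero.1 ((CStarRing.star_mul_self_eq_zero_iff _).1 h1)).symm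

/-- If `S* S = T* T`, then `T` factors through `S` by a partial isometry with initial space the
closure of the range of `S`. -/
theorem exists_partialIsometry_mul_eq {A : VonNeumannAlgebra H} {S T : H →L[ℂ] H}
    (hS : S ∈ A) (hT : T ∈ A) (h : star S * S = star T * T) :
    ∃ V ∈ A, V * S = T ∧ star V * V = projSup {S} := by
  set P := projSup {S} with hP
  have hPproj : IsStarProjection P := isStarProjection_projSup _
  have hPS : P * S = S := projSup_mul_of_mem rfl
  have hPA : P ∈ A := projSup_mem (by simpa using hS)
  obtain ⟨V, hVS, hVP⟩ : ∃ V : H →L[ℂ] H, V * S = T ∧ V * P = V := by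
    set K := (⨆ p ∈ ({S} : Set (H →L[ℂ] H)), LinearMap.range (p : H →ₗ[ℂ] H)).topologicalClosure
      with hK
    have hKS : K = (LinearMap.range (S : H →ₗ[ℂ] H)).topologicalClosure := by
      rw [hK, iSup_singleton]
    have : CompleteSpace K := (Submodule.isClosed_topologicalClosure _).completeSpace_coe
    let e : H →ₗ[ℂ] K := (S : H →ₗ[ℂ] H).codRestrict K
      fun x => range_le_of_mem (Set.mem_singleton S) ⟨x, rfl⟩
    have hdense : DenseRange e := by
      intro y
      have hy : (y : H) ∈ (LinearMap.range (S : H →ₗ[ℂ] H)).topologicalClosure := hKS ▸ y.2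
      rw [← SetLike.mem_coe, Submodule.topologicalClosure_coe] at hy
      rw [closure_subtype]
      convert hy
      ext z
      simp only [Set.mem_image, Set.mem_range]
      constructor
      · rintro ⟨_, ⟨w, rfl⟩, rfl⟩
        exact ⟨w, rfl⟩
      · rintro ⟨w, rfl⟩
        exact ⟨_, ⟨w, rfl⟩, rfl⟩
    -- Since `‖S x‖ = ‖T x‖`, the assignment `S x ↦ T x` is well defined and isometric, so it
    -- extends to the closure of the range of `S`.
    let V₀ : K →L[ℂ] H := (T : H →ₗ[ℂ] H).extendOfNorm e
    have hV₀ : ∀ x, V₀ (e x) = T x := LinearMap.extendOfNorm_eq hdense ⟨1, fun x => by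
      rw [one_mul]
      exact (norm_apply_eq_of_star_mul_self_eq h x).ge⟩
    have hVS : V₀.comp K.orthogonalProjectionOnto * S = T := by
      ext x
      rw [← ContinuousLinearMap.coe_coe T, ContinuousLinearMap.coe_coe, ← hV₀ x]
      simp only [mul_apply_eq_comp, ContinuousLinearMap.comp_apply]
      congr 1
      exact Submodule.orthogonalProjectionOnto_mem_subspace_eq_self (e x)
    refine ⟨V₀.comp K.orthogonalProjectionOnto, hVS, ?_⟩
    ext x
    simp only [mul_apply_eq_comp, ContinuousLinearMap.comp_apply]
    congr 1
    exact Submodule.orthogonalProjectionOnto_mem_subspace_eq_self (K.orthogonalProjectionOnto x)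
  refine ⟨V, mem_of_forall_commutant fun a ha => ?_, hVS, ?_⟩
  -- Commutation with `a` need only be tested on the range of `S`: `V * P = V`, and `P ∈ A` commutes
  -- with `a`.
  · have h1 : (a * V) * P = (V * a) * P := by
      refine mul_projSup_congr fun p hp => ?_
      rw [Set.mem_singleton_iff.1 hp, mul_assoc, hVS, mul_assoc, commutant_mul_comm ha hS,
        ← mul_assoc, hVS, commutant_mul_comm ha hT]
    rw [mul_assoc, hVP, mul_assoc, commutant_mul_comm ha hPA, ← mul_assoc, hVP] at h1
    exact h1
  · have hPV : P * star V = star V := by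
      simpa [hPproj.isSelfAdjoint.star_eq] using congr(star $hVP)
    have h1 : star S * (star V * V * S - S) = 0 := by
      rw [mul_sub, mul_assoc, hVS, ← mul_assoc, ← star_mul, hVS, h, sub_self]
    have h2 : P * (star V * V * S - S) = 0 := by
      ext x
      refine projSup_apply_eq_zero fun p hp => ?_
      rw [Set.mem_singleton_iff.1 hp]
      exact congr($h1 x)
    have h3 : star V * V * S = S := by
      rw [mul_sub, hPS, ← mul_assoc, ← mul_assoc, hPV, sub_eq_zero] at h2
      exact h2
    have h4 : star V * V * P = P :=
      mul_projSup fun p hp => by rw [Set.mem_singleton_iff.1 hp, h3]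
    rw [← h4, mul_assoc, hVP]

theorem cfcAbs_mem {A : VonNeumannAlgebra H} {T : H →L[ℂ] H} (hT : T ∈ A) : CFC.abs T ∈ A :=
  mem_of_forall_commutant fun a ha => Commute.cfcAbs_right (a := T) (b := a)
    (commutant_mul_comm ha hT).symm (commutant_mul_comm (star_mem ha) hT).symm

/-- The phase of an element of a von Neumann algebra. -/
theorem exists_phase {A : VonNeumannAlgebra H} {T : H →L[ℂ] H} (hT : T ∈ A) :
    ∃ V ∈ A, IsStarProjection (star V * V) ∧ (∀ x, V x = 0 ↔ T x = 0) ∧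
      (∀ Q : H →L[ℂ] H, Q * T = T → Q * V = V) := by
  have hsa : star (CFC.abs T) = CFC.abs T := (CFC.abs_nonneg T).isSelfAdjoint.star_eq
  obtain ⟨V, hV, hVT, hVP⟩ := exists_partialIsometry_mul_eq (cfcAbs_mem hT) hT
    (by rw [hsa, CFC.abs_mul_abs])
  have hnorm := norm_apply_eq_of_star_mul_self_eq (S := CFC.abs T) (T := T)
    (by rw [hsa, CFC.abs_mul_abs])
  have hVV : V * projSup {CFC.abs T} = V :=
    hVP ▸ mul_star_mul_self (hVP ▸ isStarProjection_projSup _)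
  refine ⟨V, hV, hVP ▸ isStarProjection_projSup _, fun x => ⟨fun hx => ?_, fun hx => ?_⟩, ?_⟩
  · have h1 : projSup {CFC.abs T} x = 0 := by
      rw [← hVP, mul_apply_eq_comp, hx, map_zero]
    rw [← norm_eq_zero, ← hnorm, norm_eq_zero]
    have h2 : CFC.abs T * projSup {CFC.abs T} = CFC.abs T := by
      have := congr(star $(projSup_mul_of_mem (Set.mem_singleton (CFC.abs T))))
      simpa [(isStarProjection_projSup _).isSelfAdjoint.star_eq, hsa] using this
    rw [← h2, mul_apply_eq_comp, h1, map_zero]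
  · have h1 : projSup {CFC.abs T} x = 0 := projSup_apply_eq_zero fun p hp => by
      rw [Set.mem_singleton_iff.1 hp, hsa, ← norm_eq_zero, hnorm, hx, norm_zero]
    rw [← hVV, mul_apply_eq_comp, h1, map_zero]
  · intro Q hQ
    have : Q * V * projSup {CFC.abs T} = V * projSup {CFC.abs T} :=
      mul_projSup_congr fun p hp => by
        rw [Set.mem_singleton_iff.1 hp, mul_assoc, hVT, hQ]
    rwa [mul_assoc, hVV] at this

/-! ### Sums of orthogonal partial isometries -/

theorem eq_of_mul_eq {p q : H →L[ℂ] H} (hp : IsStarProjection p) (hq : IsStarProjection q)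
    (h₁ : p * q = q) (h₂ : q * p = p) : p = q := by
  have := congr(star $h₂)
  rw [star_mul, hp.isSelfAdjoint.star_eq, hq.isSelfAdjoint.star_eq] at this
  rw [← this, h₁]

theorem hasSum_mem {A : VonNeumannAlgebra H} {ι : Type*} {f : ι → H →L[ℂ] H} {T : H →L[ℂ] H}
    (hf : ∀ i, f i ∈ A) (h : HasSum f T) : T ∈ A := by
  refine mem_of_forall_commutant fun a ha => ?_
  have h1 := h.mul_left a
  simp only [commutant_mul_comm ha (hf _)] at h1
  exact h1.unique (h.mul_right a)

theorem smul_mem' {A : VonNeumannAlgebra H} {x : H →L[ℂ] H} (c : ℂ) (hx : x ∈ A) : c • x ∈ A :=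
  mem_of_forall_commutant fun a ha => by
    rw [mul_smul_comm, smul_mul_assoc, commutant_mul_comm ha hx]

theorem norm_le_one_of_star_mul_self {V : H →L[ℂ] H} (h : IsStarProjection (star V * V)) :
    ‖V‖ ≤ 1 := by
  have h1 := h.norm_le
  rw [CStarRing.norm_star_mul_self] at h1
  nlinarith [norm_nonneg V]

/-- Strongly convergent sums are avoided by damping: with summable `c i > 0`, the series `T = ∑ c i
• w i` and `S = ∑ c i • e i` converge in norm. Orthogonality gives `T* T = S* S`, and the partial
isometry carrying `S` to `T` is the undamped sum of the `w i`. -/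
theorem exists_sum_partialIsometry {A : VonNeumannAlgebra H} {ι : Type*} [Countable ι]
    {w : ι → H →L[ℂ] H} (hw : ∀ i, w i ∈ A) (hproj : ∀ i, IsStarProjection (star (w i) * w i))
    (hl : ∀ i j, i ≠ j → star (w i) * w j = 0) (hr : ∀ i j, i ≠ j → w i * star (w j) = 0) :
    ∃ W ∈ A, (∀ i, W * (star (w i) * w i) = w i) ∧
      star W * W = projSup (Set.range fun i => star (w i) * w i) := by
  have : Encodable ι := Encodable.ofCountable ι
  obtain ⟨c, hpos, ⟨s, hs, -⟩⟩ := posSumOfEncodable one_pos ι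
  have hsum : ∀ v : ι → H →L[ℂ] H, (∀ i, ‖v i‖ ≤ 1) → Summable fun i => (c i : ℂ) • v i := by
    intro v hv
    refine Summable.of_norm_bounded hs.summable fun i => ?_
    rw [norm_smul, Complex.norm_real, Real.norm_of_nonneg (hpos i).le]
    exact mul_le_of_le_one_right (hpos i).le (hv i)
  set e : ι → H →L[ℂ] H := fun i => star (w i) * w i with he
  have hwe : ∀ i, w i * e i = w i := fun i => mul_star_mul_self (hproj i)
  have hee : ∀ i j, i ≠ j → e i * e j = 0 := fun i j hij => by
    simp only [he]
    rw [mul_assoc, ← mul_assoc (w i), hr i j hij, zero_mul, mul_zero]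
  obtain ⟨T, hT⟩ := hsum w fun i => norm_le_one_of_star_mul_self (hproj i)
  obtain ⟨S, hS⟩ := hsum e fun i => (hproj i).norm_le
  have single : ∀ {f : ι → H →L[ℂ] H} {X : H →L[ℂ] H} (i : ι), HasSum f X →
      (∀ j, j ≠ i → f j = 0) → X = f i := fun i hf h0 => hf.unique (hasSum_single i h0)
  have hSe : ∀ i, S * e i = (c i : ℂ) • e i := fun i => by
    have := single i (hS.mul_right (e i)) fun j hj => by rw [smul_mul_assoc, hee j i hj, smul_zero]
    rw [this, smul_mul_assoc, (hproj i).isIdempotentElem.eq]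
  have hTe : ∀ i, T * e i = (c i : ℂ) • w i := fun i => by
    have := single i (hT.mul_right (e i)) fun j hj => by
      rw [smul_mul_assoc, ← hwe j, mul_assoc, hee j i hj, mul_zero, smul_zero]
    rw [this, smul_mul_assoc, hwe]
  have hstar : ∀ {v : ι → H →L[ℂ] H} {X : H →L[ℂ] H}, HasSum (fun i => (c i : ℂ) • v i) X →
      HasSum (fun i => (c i : ℂ) • star (v i)) (star X) := fun h => by
    simpa [star_smul] using h.star
  have hTw : ∀ i, star T * w i = (c i : ℂ) • e i := fun i => by
    have := single i ((hstar hT).mul_right (w i)) fun j hj => by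
      rw [smul_mul_assoc, hl j i hj, smul_zero]
    rw [this, smul_mul_assoc]
  have hSsa : star S = S := by
    have := hstar hS
    simp only [fun i => (hproj i).isSelfAdjoint.star_eq, he] at this
    exact this.unique hS
  have key : star S * S = star T * T := by
    rw [hSsa]
    have h1 := hS.mul_left S
    have h2 := hT.mul_left (star T)
    simp only [mul_smul_comm, hSe, hTw] at h1 h2
    exact h1.unique h2
  obtain ⟨W, hW, hWS, hWW⟩ := exists_partialIsometry_mul_eq
    (hasSum_mem (fun i => smul_mem' _ (mul_mem (star_mem (hw i)) (hw i))) hS)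
    (hasSum_mem (fun i => smul_mem' _ (hw i)) hT) key
  have hc : ∀ i, (c i : ℂ) ≠ 0 := fun i => Complex.ofReal_ne_zero.2 (hpos i).ne'
  refine ⟨W, hW, fun i => ?_, hWW.trans ?_⟩
  · have h1 : (c i : ℂ) • (W * e i) = (c i : ℂ) • w i := by
      rw [← mul_smul_comm, ← hSe, ← mul_assoc, hWS, hTe]
    exact smul_right_injective _ (hc i) h1
  · refine eq_of_mul_eq (isStarProjection_projSup _) (isStarProjection_projSup _) ?_ ?_
    · refine mul_projSup ?_
      rintro _ ⟨i, rfl⟩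
      have h1 : (c i : ℂ) • (projSup {S} * e i) = (c i : ℂ) • e i := by
        rw [← mul_smul_comm, ← hSe, ← mul_assoc, projSup_mul_of_mem (Set.mem_singleton S)]
      exact smul_right_injective _ (hc i) h1
    · refine mul_projSup fun p hp => ?_
      rw [Set.mem_singleton_iff.1 hp]
      have h1 := hS.mul_left (projSup (Set.range e))
      simp only [mul_smul_comm, projSup_mul_of_mem (Set.mem_range_self _)] at h1
      exact h1.unique hS

/-! ### Partial isometries in finite algebras extend to unitaries -/

theorem IsFinite.mul_star_self {A : VonNeumannAlgebra H} (hA : A.IsFinite) {v : H →L[ℂ] H}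
    (hv : v ∈ A) (h : star v * v = 1) : v * star v = 1 := by
  have hp : IsStarProjection (v * star v) := by
    refine ⟨?_, IsSelfAdjoint.mul_star_self v⟩
    change v * star v * (v * star v) = v * star v
    rw [mul_assoc, ← mul_assoc (star v), h, one_mul]
  exact hA.2 _ ⟨mul_mem hv (star_mem hv), hp⟩ hp.le_one
    ⟨star v, star_mem hv, by rw [star_star], by rw [star_star, h]⟩

theorem isStarProjection_mul_star {V : H →L[ℂ] H} (h : IsStarProjection (star V * V)) :
    IsStarProjection (V * star V) := by
  refine ⟨?_, IsSelfAdjoint.mul_star_self V⟩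
  change V * star V * (V * star V) = V * star V
  rw [← mul_assoc, mul_assoc V, mul_star_mul_self h]

/-- In a finite algebra, an element `W` with `(1 - W W*) A (1 - W* W) = 0` is unitary. -/
theorem IsFinite.star_mul_self_of_corner {A : VonNeumannAlgebra H} (hA : A.IsFinite)
    {W : H →L[ℂ] H} (hW : W ∈ A)
    (hcorner : ∀ a ∈ A, (1 - W * star W) * a * (1 - star W * W) = 0) : star W * W = 1 := by
  set E := star W * W with hE
  set F := W * star W with hF
  have hEA : 1 - E ∈ A := sub_mem (one_mem A) (mul_mem (star_mem hW) hW)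
  -- The closed span of the ranges of `A * (1 - E)` is invariant under both `A` and its commutant,
  -- so `z` is the central support of `1 - E`; the corner condition then says `z ≤ F`.
  set S : Set (H →L[ℂ] H) := {x | ∃ a ∈ A, x = a * (1 - E)} with hS
  set z := projSup S with hz
  have hzp : IsStarProjection z := isStarProjection_projSup _
  have hzA : z ∈ A := projSup_mem fun p hp => by
    obtain ⟨a, ha, rfl⟩ := hp
    exact mul_mem ha hEA
  have hzc : z ∈ A.commutant := by
    refine mem_of_invariant hzp fun a ha => mul_projSup_congr ?_
    rw [commutant_commutant] at ha
    rintro _ ⟨b, hb, rfl⟩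
    rw [mul_assoc, ← mul_assoc a]
    exact projSup_mul_of_mem ⟨_, mul_mem ha hb, rfl⟩
  have hzE : z * (1 - E) = 1 - E := projSup_mul_of_mem ⟨1, one_mem A, (one_mul _).symm⟩
  have hFz : (1 - F) * z = 0 := mul_projSup_eq_zero (by
    rintro _ ⟨a, ha, rfl⟩
    rw [← mul_assoc, hcorner a ha])
  have hzW : z * W = W * z := commutant_mul_comm hzc hW
  have hzW' : z * star W = star W * z := commutant_mul_comm hzc (star_mem hW)
  have hzz : z * z = z := hzp.isIdempotentElem.eq
  have hzs : star z = z := hzp.isSelfAdjoint.star_eq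
  have hFz' : F * z = z := by rw [sub_mul, one_mul, sub_eq_zero] at hFz; exact hFz.symm
  -- Replacing `W` by the identity off `z` gives a coisometry, which finiteness makes unitary; this
  -- forces `z ≤ E`, while `1 - E ≤ z`.
  have h1 : (W * z + (1 - z)) * star (W * z + (1 - z)) = 1 := by
    have : (W * z + (1 - z)) * star (W * z + (1 - z)) =
        W * (z * z) * star W + W * (z - z * z) + (z - z * z) * star W + (1 - z - (z - z * z)) := by
      simp only [star_add, star_mul, star_sub, star_one, hzs]
      noncomm_ring
    rw [this, hzz, sub_self, mul_zero, zero_mul, mul_assoc, hzW', ← mul_assoc]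
    rw [← hF, hFz']
    abel
  have hUA : W * z + (1 - z) ∈ A := add_mem (mul_mem hW hzA) (sub_mem (one_mem A) hzA)
  have h2 := hA.mul_star_self (star_mem hUA) (by rw [star_star, h1])
  rw [star_star] at h2
  have h3 : star (W * z + (1 - z)) * (W * z + (1 - z)) = z * E * z + (1 - z) := by
    have : star (W * z + (1 - z)) * (W * z + (1 - z)) =
        z * E * z + z * star W * (1 - z) + (1 - z) * (W * z) + (1 - z - (z - z * z)) := by
      simp only [star_add, star_mul, star_sub, star_one, hzs, hE]
      noncomm_ring
    rw [this, hzz, hzW', ← hzW, ← mul_assoc (1 - z), mul_assoc (star W), hzp.mul_one_sub_self,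
      hzp.one_sub_mul_self]
    simp
  rw [h3] at h2
  have h4 : z * E * z = z := by
    rw [← sub_eq_zero] at h2 ⊢
    rw [← h2]; abel
  have h5 : E * z = z * E := (commutant_mul_comm hzc (mul_mem (star_mem hW) hW)).symm
  rw [mul_assoc, h5, ← mul_assoc, hzz] at h4
  rw [mul_sub, mul_one, h4, sub_self] at hzE
  exact (sub_eq_zero.1 hzE.symm).symm

/-- Unit vectors chosen in the ranges are orthonormal, hence at mutual distance `√2`, so balls of
radius `1 / 2` around them are disjoint. -/
theorem countable_of_star_mul_eq_zero [TopologicalSpace.SeparableSpace H]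
    {F : Set (H →L[ℂ] H)} (h0 : ∀ w ∈ F, w ≠ 0)
    (hF : ∀ w ∈ F, ∀ w' ∈ F, w ≠ w' → star w * w' = 0) : F.Countable := by
  have : ∀ w : F, ∃ x : H, ‖(w : H →L[ℂ] H) x‖ = 1 := by
    intro w
    obtain ⟨y, hy⟩ : ∃ y, (w : H →L[ℂ] H) y ≠ 0 := by
      by_contra! h
      exact h0 w w.2 (ContinuousLinearMap.ext h)
    refine ⟨((‖(w : H →L[ℂ] H) y‖⁻¹ : ℝ) : ℂ) • y, ?_⟩
    rw [map_smul, norm_smul, Complex.norm_real, norm_inv, norm_norm,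
      inv_mul_cancel₀ (norm_ne_zero_iff.2 hy)]
  choose x hx using this
  have horth : ∀ w w' : F, w ≠ w' →
      inner ℂ ((w : H →L[ℂ] H) (x w)) ((w' : H →L[ℂ] H) (x w')) = 0 := by
    intro w w' hne
    rw [← ContinuousLinearMap.adjoint_inner_right, ← ContinuousLinearMap.star_eq_adjoint,
      ← mul_apply_eq_comp, hF w w.2 w' w'.2 (Subtype.coe_ne_coe.2 hne)]
    simp
  have hd : (Set.univ : Set F).PairwiseDisjoint
      fun w => Metric.ball ((w : H →L[ℂ] H) (x w)) (1 / 2) := by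
    intro w _ w' _ hne
    refine Metric.ball_disjoint_ball ?_
    have h1 := norm_sub_sq (𝕜 := ℂ) ((w : H →L[ℂ] H) (x w)) ((w' : H →L[ℂ] H) (x w'))
    rw [horth w w' hne, hx, hx, ← dist_eq_norm] at h1
    norm_num at h1
    nlinarith [dist_nonneg (x := (w : H →L[ℂ] H) (x w)) (y := (w' : H →L[ℂ] H) (x w'))]
  have h2 := hd.countable_of_isOpen (fun _ _ => Metric.isOpen_ball)
    (fun w _ => ⟨_, Metric.mem_ball_self (by norm_num)⟩)
  exact Set.countable_univ_iff.1 h2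

/-- In a finite von Neumann algebra on a separable space, every partial isometry extends to a
unitary of the algebra. -/
theorem IsFinite.exists_unitary_extension [TopologicalSpace.SeparableSpace H]
    {A : VonNeumannAlgebra H} (hA : A.IsFinite) {v : H →L[ℂ] H} (hv : v ∈ A)
    (hproj : IsStarProjection (star v * v)) :
    ∃ u ∈ A, u ∈ unitary (H →L[ℂ] H) ∧ u * (star v * v) = v := by
  rcases eq_or_ne v 0 with rfl | hv0
  · exact ⟨1, one_mem A, one_mem _, by simp⟩
  -- Zorn is applied to families of nonzero partial isometries in `A` with mutually orthogonal
  -- initial spaces and mutually orthogonal final spaces.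
  let fams : Set (Set (H →L[ℂ] H)) := {F |
    (∀ w ∈ F, w ∈ A ∧ IsStarProjection (star w * w) ∧ w ≠ 0) ∧
    ∀ w ∈ F, ∀ w' ∈ F, w ≠ w' → star w * w' = 0 ∧ w * star w' = 0}
  have hchain : ∀ c ⊆ fams, IsChain (· ⊆ ·) c → c.Nonempty → ∃ ub ∈ fams, ∀ s ∈ c, s ⊆ ub := by
    intro c hc hch _
    refine ⟨⋃₀ c, ⟨?_, ?_⟩, fun s hs => Set.subset_sUnion_of_mem hs⟩
    · rintro w ⟨s, hs, hw⟩
      exact (hc hs).1 w hw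
    · rintro w ⟨s, hs, hw⟩ w' ⟨s', hs', hw'⟩ hne
      rcases hch.total hs hs' with h | h
      · exact (hc hs').2 w (h hw) w' hw' hne
      · exact (hc hs).2 w hw w' (h hw') hne
  obtain ⟨F, hvF, hF⟩ := zorn_subset_nonempty fams hchain {v} (by simp [fams, hv, hproj, hv0])
  have hFfams := hF.prop
  have : Countable F := (countable_of_star_mul_eq_zero (fun w hw => (hFfams.1 w hw).2.2)
    fun w hw w' hw' hne => (hFfams.2 w hw w' hw' hne).1).to_subtype
  obtain ⟨W, hW, hWw, hWW⟩ := exists_sum_partialIsometry (A := A)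
    (w := fun w : F => (w : H →L[ℂ] H))
    (fun w => (hFfams.1 w w.2).1) (fun w => (hFfams.1 w w.2).2.1)
    (fun w w' hne => (hFfams.2 w w.2 w' w'.2 (Subtype.coe_ne_coe.2 hne)).1)
    (fun w w' hne => (hFfams.2 w w.2 w' w'.2 (Subtype.coe_ne_coe.2 hne)).2)
  have hWp : IsStarProjection (star W * W) := hWW ▸ isStarProjection_projSup _
  have hEe : ∀ w ∈ F, star W * W * (star w * w) = star w * w := fun w hw => by
    rw [hWW]
    exact projSup_mul_of_mem ⟨⟨w, hw⟩, rfl⟩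
  have hww : ∀ w ∈ F, w * (star w * w) = w := fun w hw => mul_star_mul_self (hFfams.1 w hw).2.1
  have hwE : ∀ w ∈ F, star W * W * star w = star w := fun w hw => by
    have h1 := congr(star $(hww w hw))
    simp only [star_mul, star_star] at h1
    rw [← h1, ← mul_assoc, hEe w hw]
  have hWFw : ∀ w ∈ F, W * star W * w = w := fun w hw => by
    have h1 : W * (star w * w) = w := hWw ⟨w, hw⟩
    rw [← h1, ← mul_assoc, mul_assoc W (star W) W, mul_star_mul_self hWp]
  have hcorner : ∀ a ∈ A, (1 - W * star W) * a * (1 - star W * W) = 0 := by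
    intro a ha
    by_contra hne
    -- The phase of a nonzero corner element is orthogonal to every member of `F` on both sides.
    -- Maximality puts it in `F`, so it is orthogonal to itself.
    obtain ⟨V, hV, hVp, hker, hran⟩ := exists_phase (A := A)
      (T := (1 - W * star W) * a * (1 - star W * W))
      (mul_mem (mul_mem (sub_mem (one_mem A) (mul_mem hW (star_mem hW))) ha)
        (sub_mem (one_mem A) (mul_mem (star_mem hW) hW)))
    have hFV : (1 - W * star W) * V = V := hran _ (by
      rw [← mul_assoc, ← mul_assoc, (isStarProjection_mul_star hWp).one_sub.isIdempotentElem.eq])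
    have hVE : V * (star W * W) = 0 := by
      ext x
      refine (hker _).2 ?_
      have h1 : (1 - W * star W) * a * (1 - star W * W) * (star W * W) = 0 := by
        rw [mul_assoc, hWp.one_sub_mul_self, mul_zero]
      exact congr($h1 x)
    have hV0 : V ≠ 0 := by
      rintro rfl
      exact hne (ContinuousLinearMap.ext fun x => (hker x).1 rfl)
    have hVw : ∀ w ∈ F, V * star w = 0 := fun w hw => by
      rw [← hwE w hw, ← mul_assoc, hVE, zero_mul]
    have hwV : ∀ w ∈ F, star w * V = 0 := fun w hw => by
      have h1 := congr(star $(hWFw w hw))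
      simp only [star_mul, star_star] at h1
      rw [← h1, ← hFV, mul_assoc, ← mul_assoc _ (1 - _) V,
        (isStarProjection_mul_star hWp).mul_one_sub_self, zero_mul, mul_zero]
    have hVF : V ∈ F := by
      have hins : insert V F ∈ fams := by
        refine ⟨?_, ?_⟩
        · rintro w (rfl | hw)
          · exact ⟨hV, hVp, hV0⟩
          · exact hFfams.1 w hw
        · rintro w (rfl | hw) w' (rfl | hw') hne
          · exact absurd rfl hne
          · exact ⟨by simpa using congr(star $(hwV w' hw')), hVw w' hw'⟩
          · exact ⟨hwV w hw, by simpa using congr(star $(hVw w hw))⟩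
          · exact hFfams.2 w hw w' hw' hne
      exact hF.le_of_ge hins (Set.subset_insert V F) (Set.mem_insert V F)
    apply hV0
    rw [← hww V hVF, ← mul_assoc, hVw V hVF, zero_mul]
  have h1 := hA.star_mul_self_of_corner hW hcorner
  exact ⟨W, hW, ⟨h1, hA.mul_star_self hW h1⟩, hWw ⟨v, hvF rfl⟩⟩

/-! ### Increasing sequences of projections -/

theorem mul_eq_swap {p q : H →L[ℂ] H} (hp : IsStarProjection p) (hq : IsStarProjection q)
    (h : p * q = q) : q * p = q := by
  simpa [hp.isSelfAdjoint.star_eq, hq.isSelfAdjoint.star_eq] using congr(star $h)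

theorem isStarProjection_sub {p q : H →L[ℂ] H} (hp : IsStarProjection p)
    (hq : IsStarProjection q) (h : q * p = p) : IsStarProjection (q - p) :=
  (hp.le_iff_sub hq).1 ((hp.le_iff_mul_eq_right hq).2 h)

theorem mul_eq_of_le {E : ℕ → H →L[ℂ] H} (hE : ∀ n, IsStarProjection (E n))
    (hmono : ∀ n, E (n + 1) * E n = E n) {m n : ℕ} (h : n ≤ m) : E m * E n = E n := by
  have : Monotone E := monotone_nat_of_le_succ fun n =>
    ((hE n).le_iff_mul_eq_right (hE _)).2 (hmono n)
  exact ((hE n).le_iff_mul_eq_right (hE m)).1 (this h)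

theorem increment_mul_increment {E : ℕ → H →L[ℂ] H} (hE : ∀ n, IsStarProjection (E n))
    (hmono : ∀ n, E (n + 1) * E n = E n) {i j : ℕ} (h : i ≠ j) :
    (E (i + 1) - E i) * (E (j + 1) - E j) = 0 := by
  have h1 : ∀ {m n : ℕ}, n ≤ m → E m * E n = E n := mul_eq_of_le hE hmono
  have h2 : ∀ {m n : ℕ}, n ≤ m → E n * E m = E n := fun h => mul_eq_swap (hE _) (hE _) (h1 h)
  rcases lt_or_gt_of_ne h with h | h
  · rw [mul_sub, sub_mul, sub_mul, h2 (by omega), h2 (by omega), h2 (by omega), h2 (by omega)]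
    abel
  · rw [mul_sub, sub_mul, sub_mul, h1 (by omega), h1 (by omega), h1 (by omega), h1 (by omega)]
    abel

theorem projSup_increment {E : ℕ → H →L[ℂ] H} (h0 : E 0 = 0) :
    projSup (Set.range fun n => E (n + 1) - E n) = projSup (Set.range E) := by
  refine eq_of_mul_eq (isStarProjection_projSup _) (isStarProjection_projSup _) ?_ ?_
  · refine mul_projSup ?_
    rintro _ ⟨n, rfl⟩
    induction n with
    | zero => rw [h0, mul_zero]
    | succ n ih =>
      have h1 : projSup (Set.range fun n => E (n + 1) - E n) * (E (n + 1) - E n) =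
        E (n + 1) - E n := projSup_mul_of_mem ⟨n, rfl⟩
      rw [mul_sub, ih] at h1
      exact sub_left_injective h1
  · refine mul_projSup ?_
    rintro _ ⟨n, rfl⟩
    simp only [mul_sub]
    rw [projSup_mul_of_mem (Set.mem_range_self n), projSup_mul_of_mem (Set.mem_range_self (n + 1))]

/-! ### Comparison of projections -/

/-- A unitary form of Kaplansky's parallelogram law: `p ∨ q - p` is equivalent to a subprojection
of `q`. -/
theorem IsFinite.exists_unitary_sup_sub [TopologicalSpace.SeparableSpace H]
    {A : VonNeumannAlgebra H} (hA : A.IsFinite) {p q : H →L[ℂ] H} (hp : p ∈ A.projections)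
    (hq : q ∈ A.projections) :
    ∃ t ∈ A, t ∈ unitary (H →L[ℂ] H) ∧ q * t * (projSup {p, q} - p) = t * (projSup {p, q} - p) := by
  set r := projSup {p, q} with hr
  have hrp : r * p = p := projSup_mul_of_mem (by simp)
  have hrA : r ∈ A := projSup_mem (by simp [hp.1, hq.1])
  have hrproj : IsStarProjection r := isStarProjection_projSup _
  have hrpp : IsStarProjection (r - p) := isStarProjection_sub hp.2 hrproj hrp
  obtain ⟨V, hV, hVp, hker, hran⟩ := exists_phase (A := A) (T := q * (1 - p))
    (mul_mem hq.1 (sub_mem (one_mem A) hp.1))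
  have hqV : q * V = V := hran q (by rw [← mul_assoc, hq.2.isIdempotentElem.eq])
  -- If `V` kills a vector, its component under `1 - p` is killed by both `p` and `q`, hence by `r`.
  -- So `r - p` lies under the initial projection of `V`.
  have h1 : (r - p) * (1 - star V * V) = 0 := by
    ext x
    have h2 : V ((1 - star V * V) x) = 0 := by
      have : V * (1 - star V * V) = 0 := by rw [mul_sub, mul_one, mul_star_mul_self hVp, sub_self]
      exact congr($this x)
    have h3 : q ((1 - p) ((1 - star V * V) x)) = 0 := (hker _).1 h2
    have h4 : p ((1 - p) ((1 - star V * V) x)) = 0 := congr($(hp.2.mul_one_sub_self) _)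
    have h5 : r ((1 - p) ((1 - star V * V) x)) = 0 := projSup_apply_eq_zero (by
      rintro _ (rfl | rfl)
      · rw [hp.2.isSelfAdjoint.star_eq, h4]
      · rw [hq.2.isSelfAdjoint.star_eq, h3])
    have h6 : r - p = r * (1 - p) := by rw [mul_sub, mul_one, hrp]
    rw [h6]
    exact h5
  have h2 : star V * V * (r - p) = r - p := by
    have := congr(star $h1)
    rw [star_mul, hrpp.isSelfAdjoint.star_eq, hVp.one_sub.isSelfAdjoint.star_eq, star_zero,
      sub_mul, one_mul, sub_eq_zero] at this
    exact this.symm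
  have h3 : star (V * (r - p)) * (V * (r - p)) = r - p := by
    rw [star_mul, mul_assoc, ← mul_assoc (star V), h2, hrpp.isSelfAdjoint.star_eq,
      hrpp.isIdempotentElem.eq]
  obtain ⟨t, htA, htu, ht⟩ := hA.exists_unitary_extension (mul_mem hV (sub_mem hrA hp.1))
    (by rw [h3]; exact hrpp)
  rw [h3] at ht
  exact ⟨t, htA, htu, by rw [mul_assoc, ht, ← mul_assoc, hqV]⟩

/-- The unitaries `y` moving `E n` under `1 - Q` need not be compatible for different `n`. Once
corrected so that each agrees with its predecessor on `E n`, they glue to an isometry with range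
under `1 - Q`; by finiteness it is onto. -/
theorem IsFinite.eq_zero_of_exhaustion [TopologicalSpace.SeparableSpace H]
    {A : VonNeumannAlgebra H} (hA : A.IsFinite) {Q : H →L[ℂ] H} (hQ : Q ∈ A.projections)
    {E : ℕ → H →L[ℂ] H} (hE : ∀ n, E n ∈ A.projections) (h0 : E 0 = 0)
    (hmono : ∀ n, E (n + 1) * E n = E n) (hsup : projSup (Set.range E) = 1)
    (hsub : ∀ n, ∃ y ∈ A, y ∈ unitary (H →L[ℂ] H) ∧ Q * y * E n = 0) : Q = 0 := by
  let X : ℕ → Type _ := fun n =>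
    {U : H →L[ℂ] H // U ∈ A ∧ U ∈ unitary (H →L[ℂ] H) ∧ Q * U * E n = 0}
  have hEs : ∀ n, star (E n) = E n := fun n => (hE n).2.isSelfAdjoint.star_eq
  have hEE : ∀ n, E n * E n = E n := fun n => (hE n).2.isIdempotentElem.eq
  have hQs : star Q = Q := hQ.2.isSelfAdjoint.star_eq
  have hQQ : Q * Q = Q := hQ.2.isIdempotentElem.eq
  -- With `y` chosen for `E (n + 1)`, the operator `U * E n * star y + Q` is a partial isometry with
  -- initial projection `y * E n * star y + Q`. A unitary extension `t` fixes `Q` and carries `y * E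
  -- n` to `U * E n`, so `t * y` is the required correction.
  have hstep : ∀ n (U : X n), ∃ U' : X (n + 1), U'.1 * E n = U.1 * E n := by
    rintro n ⟨U, hUA, hUu, hQU⟩
    obtain ⟨y, hyA, hyu, hQy⟩ := hsub (n + 1)
    have hQy' : Q * y * E n = 0 := by rw [← hmono n, ← mul_assoc, hQy, zero_mul]
    have hEy : E n * star y * Q = 0 := by
      simpa [hEs, hQs, mul_assoc] using congr(star $hQy')
    have hEU : E n * star U * Q = 0 := by
      simpa [hEs, hQs, mul_assoc] using congr(star $hQU)
    have hUU : star U * U = 1 := hUu.1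
    have hyy : star y * y = 1 := hyu.1
    have hss : star (U * E n * star y + Q) * (U * E n * star y + Q) =
        y * E n * star y + Q := by
      have : star (U * E n * star y + Q) * (U * E n * star y + Q) =
          y * E n * (star U * U) * E n * star y + y * (E n * star U * Q) +
            Q * U * E n * star y + Q * Q := by
        simp only [star_add, star_mul, star_star, hEs, hQs]
        noncomm_ring
      rw [this, hUU, hEU, hQU, hQQ, mul_one, mul_assoc y, hEE]
      simp
    have hssp : IsStarProjection (y * E n * star y + Q) := by
      refine ⟨?_, ?_⟩
      · change (y * E n * star y + Q) * (y * E n * star y + Q) = y * E n * star y + Q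
        have : (y * E n * star y + Q) * (y * E n * star y + Q) =
            y * E n * (star y * y) * E n * star y + y * (E n * star y * Q) +
              Q * y * E n * star y + Q * Q := by noncomm_ring
        rw [this, hyy, hEy, hQy', hQQ, mul_one, mul_assoc y, hEE]
        simp
      · rw [isSelfAdjoint_iff]
        simp only [star_add, star_mul, star_star, hEs, hQs, mul_assoc]
    obtain ⟨t, htA, htu, ht⟩ := hA.exists_unitary_extension
      (v := U * E n * star y + Q)
      (add_mem (mul_mem (mul_mem hUA (hE n).1) (star_mem hyA)) hQ.1) (hss ▸ hssp)
    rw [hss] at ht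
    have htQ : t * Q = Q := by
      have h1 := congr($ht * Q)
      have h2 : t * (y * E n * star y + Q) * Q = t * y * (E n * star y * Q) + t * (Q * Q) := by
        noncomm_ring
      have h3 : (U * E n * star y + Q) * Q = U * (E n * star y * Q) + Q * Q := by noncomm_ring
      simpa only [h2, h3, hEy, hQQ, mul_zero, zero_add] using h1
    have hQt : Q * t = Q := by
      have h1 : star t * Q = Q := by
        conv_lhs => rw [← htQ, ← mul_assoc, htu.1, one_mul]
      simpa [hQs] using congr(star $h1)
    have htE : t * y * E n = U * E n := by
      have h1 := congr($ht * (y * E n))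
      have h2 : t * (y * E n * star y + Q) * (y * E n) =
          t * y * E n * (star y * y) * E n + t * (Q * y * E n) := by noncomm_ring
      have h3 : (U * E n * star y + Q) * (y * E n) =
          U * E n * (star y * y) * E n + Q * y * E n := by noncomm_ring
      rwa [h2, h3, hyy, hQy', mul_one, mul_one, mul_zero, add_zero, add_zero, mul_assoc (t * y),
        mul_assoc U, hEE] at h1
    exact ⟨⟨t * y, mul_mem htA hyA, mul_mem htu hyu, by rw [← mul_assoc, hQt, hQy]⟩, htE⟩
  choose step hstep using hstep
  let U : ∀ n, X n := fun n => Nat.rec ⟨1, one_mem A, one_mem _, by rw [h0, mul_zero]⟩ step n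
  have hU : ∀ n, (U (n + 1)).1 * E n = (U n).1 * E n := fun n => hstep n (U n)
  have hle : ∀ {m n : ℕ}, n ≤ m → E m * E n = E n := mul_eq_of_le (fun n => (hE n).2) hmono
  have hUle : ∀ {m n : ℕ}, n ≤ m → (U m).1 * E n = (U n).1 * E n := by
    intro m n h
    induction m, h using Nat.le_induction with
    | base => rfl
    | succ m hm ih => rw [← ih, ← hle hm, ← mul_assoc, hU, mul_assoc]
  set D : ℕ → H →L[ℂ] H := fun n => E (n + 1) - E n with hD
  have hDp : ∀ n, IsStarProjection (D n) := fun n =>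
    isStarProjection_sub (hE n).2 (hE _).2 (hmono n)
  have hDs : ∀ n, star (D n) = D n := fun n => (hDp n).isSelfAdjoint.star_eq
  have hDD : ∀ i j, i ≠ j → D i * D j = 0 := fun i j h =>
    increment_mul_increment (fun n => (hE n).2) hmono h
  have hUD : ∀ {m n : ℕ}, n + 1 ≤ m → (U m).1 * D n = (U (n + 1)).1 * D n := by
    intro m n h
    simp only [hD, mul_sub]
    rw [hUle h, hUle (Nat.le_of_succ_le h), hU]
  have hww : ∀ i j, i < j → star ((U (i + 1)).1 * D i) * ((U (j + 1)).1 * D j) = 0 := by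
    intro i j h
    rw [← hUD (show i + 1 ≤ j + 1 by omega), star_mul, mul_assoc, ← mul_assoc (star (U (j + 1)).1),
      (U (j + 1)).2.2.1.1, one_mul, hDs, hDD i j h.ne]
  have hwp : ∀ n, star ((U (n + 1)).1 * D n) * ((U (n + 1)).1 * D n) = D n := fun n => by
    rw [star_mul, mul_assoc, ← mul_assoc (star (U (n + 1)).1),
      (U (n + 1)).2.2.1.1, one_mul, hDs, (hDp n).isIdempotentElem.eq]
  obtain ⟨W, hWA, hWw, hWW⟩ := exists_sum_partialIsometry (A := A)
    (w := fun n => (U (n + 1)).1 * D n)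
    (fun n => mul_mem (U (n + 1)).2.1 (sub_mem (hE _).1 (hE _).1))
    (fun n => (hwp n).symm ▸ hDp n)
    (fun i j h => by
      rcases lt_or_gt_of_ne h with h | h
      · exact hww i j h
      · simpa using congr(star $(hww j i h)))
    (fun i j h => by
      rw [star_mul, mul_assoc, ← mul_assoc (D i), hDs, hDD i j h, zero_mul, mul_zero])
  simp only [hwp] at hWw hWW
  have hW1 : star W * W = 1 := by rw [hWW, projSup_increment h0, hsup]
  have hQW : Q * W = 0 := by
    have h1 : Q * W * projSup (Set.range D) = 0 := by
      refine mul_projSup_eq_zero ?_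
      rintro _ ⟨n, rfl⟩
      have h2 : Q * (U (n + 1)).1 * E (n + 1) = 0 := (U (n + 1)).2.2.2
      have h3 : D n = E (n + 1) * D n := by
        simp only [hD]
        rw [mul_sub, hEE, hmono]
      rw [mul_assoc, hWw, h3, ← mul_assoc, ← mul_assoc, h2, zero_mul]
    rwa [← hWW, hW1, mul_one] at h1
  rw [← mul_one Q, ← hA.mul_star_self hWA hW1, ← mul_assoc, hQW, zero_mul]

/-- In a finite algebra, a projection that is subequivalent to every term of a sequence of
projections decreasing to zero vanishes. -/
theorem IsFinite.eq_zero_of_forall_subequiv [TopologicalSpace.SeparableSpace H]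
    {A : VonNeumannAlgebra H} (hA : A.IsFinite) {Q : H →L[ℂ] H} (hQ : Q ∈ A.projections)
    {P : ℕ → H →L[ℂ] H} (hP : ∀ n, P n ∈ A.projections)
    (hanti : ∀ n, P n * P (n + 1) = P (n + 1)) (hsup : projSup (Set.range fun n => 1 - P n) = 1)
    (hsub : ∀ n, ∃ v ∈ A, star v * v = Q ∧ P n * v = v) : Q = 0 := by
  -- The shift by one makes the exhaustion start at `0`, where the identity is an admissible unitary
  -- and from which the increments telescope.
  let E : ℕ → H →L[ℂ] H := fun n => Nat.casesOn n 0 fun n => 1 - P n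
  have hE : ∀ n, E n ∈ A.projections := fun n => by
    cases n with
    | zero => exact ⟨zero_mem A, .zero _⟩
    | succ n => exact ⟨sub_mem (one_mem A) (hP n).1, (hP n).2.one_sub⟩
  refine hA.eq_zero_of_exhaustion hQ (E := E) hE rfl (fun n => ?_) ?_ (fun n => ?_)
  · cases n with
    | zero => exact mul_zero _
    | succ n =>
      change (1 - P (n + 1)) * (1 - P n) = 1 - P n
      rw [sub_mul, one_mul, mul_sub, mul_one, mul_eq_swap (hP _).2 (hP _).2 (hanti n), sub_self,
        sub_zero]
  · have h1 : projSup (Set.range E) * projSup (Set.range fun n => 1 - P n) =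
        projSup (Set.range fun n => 1 - P n) := by
      refine mul_projSup ?_
      rintro _ ⟨n, rfl⟩
      exact projSup_mul_of_mem ⟨n + 1, rfl⟩
    rwa [hsup, mul_one] at h1
  · cases n with
    | zero => exact ⟨1, one_mem A, one_mem _, mul_zero _⟩
    | succ n =>
      obtain ⟨v, hvA, hvQ, hPv⟩ := hsub n
      obtain ⟨u, huA, huu, hu⟩ := hA.exists_unitary_extension hvA (hvQ ▸ hQ.2)
      refine ⟨star u, star_mem huA, Unitary.star_mem huu, ?_⟩
      rw [hvQ] at hu
      have h1 : (1 - P n) * (u * Q) = 0 := by rw [hu, sub_mul, one_mul, hPv, sub_self]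
      have h2 := congr(star $h1)
      simpa only [star_mul, (hP n).2.one_sub.isSelfAdjoint.star_eq, hQ.2.isSelfAdjoint.star_eq,
        star_zero] using h2

/-! ### Partial suprema -/

theorem one_sub_mul_one_sub {p q : H →L[ℂ] H} (hp : IsStarProjection p)
    (hq : IsStarProjection q) (h : q * p = p) : (1 - p) * (1 - q) = 1 - q := by
  rw [sub_mul, one_mul, mul_sub, mul_one, mul_eq_swap hq hp h, sub_self, sub_zero]

theorem projSup_mem_projections {A : VonNeumannAlgebra H} {S : Set (H →L[ℂ] H)}
    (hS : ∀ p ∈ S, p ∈ A.projections) : projSup S ∈ A.projections :=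
  ⟨projSup_mem fun p hp => (hS p hp).1, isStarProjection_projSup S⟩

/-- The suprema `q 0 ∨ ⋯ ∨ q (n - 1)`. -/
noncomputable def partialProjSup (q : ℕ → H →L[ℂ] H) : ℕ → H →L[ℂ] H
  | 0 => 0
  | n + 1 => projSup {partialProjSup q n, q n}

theorem partialProjSup_mem {A : VonNeumannAlgebra H} {q : ℕ → H →L[ℂ] H}
    (hq : ∀ n, q n ∈ A.projections) (n : ℕ) : partialProjSup q n ∈ A.projections := by
  induction n with
  | zero => exact ⟨zero_mem A, .zero _⟩
  | succ n ih =>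
    refine projSup_mem_projections ?_
    rintro _ (rfl | rfl)
    exacts [ih, hq n]

theorem partialProjSup_succ_mul (q : ℕ → H →L[ℂ] H) (n : ℕ) :
    partialProjSup q (n + 1) * partialProjSup q n = partialProjSup q n :=
  projSup_mul_of_mem (Set.mem_insert _ _)

theorem projSup_range_partialProjSup (q : ℕ → H →L[ℂ] H) :
    projSup (Set.range (partialProjSup q)) = projSup (Set.range q) := by
  refine eq_of_mul_eq (isStarProjection_projSup _) (isStarProjection_projSup _) ?_ ?_
  · refine mul_projSup ?_
    rintro _ ⟨n, rfl⟩
    have h1 : partialProjSup q (n + 1) * q n = q n := projSup_mul_of_mem (by simp)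
    rw [← h1, ← mul_assoc, projSup_mul_of_mem (Set.mem_range_self (n + 1))]
  · refine mul_projSup ?_
    rintro _ ⟨n, rfl⟩
    induction n with
    | zero => exact mul_zero _
    | succ n ih =>
      refine mul_projSup ?_
      rintro _ (rfl | rfl)
      exacts [ih, projSup_mul_of_mem (Set.mem_range_self n)]

/-- The `q n` may overlap, but the increments of their partial suprema are orthogonal. The
parallelogram law moves the `n`-th increment under `q n`, and `u n` moves it on under `p n`;
orthogonality of the `p n` allows the pieces to be summed. -/
theorem IsFinite.exists_subequiv_projSup [TopologicalSpace.SeparableSpace H]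
    {A : VonNeumannAlgebra H} (hA : A.IsFinite) {p q u : ℕ → H →L[ℂ] H}
    (hp : ∀ n, p n ∈ A.projections) (hq : ∀ n, q n ∈ A.projections)
    (huA : ∀ n, u n ∈ A) (huu : ∀ n, u n ∈ unitary (H →L[ℂ] H))
    (hpp : ∀ i j, i ≠ j → p i * p j = 0) (hpq : ∀ n, p n * u n * q n = u n * q n) :
    ∃ V ∈ A, star V * V = projSup (Set.range q) ∧
      ∀ P : H →L[ℂ] H, (∀ n, P * p n = p n) → P * V = V := by
  set R := partialProjSup q with hR
  have hRp : ∀ n, R n ∈ A.projections := partialProjSup_mem hq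
  have hmono : ∀ n, R (n + 1) * R n = R n := partialProjSup_succ_mul q
  choose t htA htu ht using fun n => hA.exists_unitary_sup_sub (hRp n) (hq n)
  set D : ℕ → H →L[ℂ] H := fun n => R (n + 1) - R n with hD
  have htD : ∀ n, q n * t n * D n = t n * D n := ht
  have hDp : ∀ n, IsStarProjection (D n) :=
    fun n => isStarProjection_sub (hRp n).2 (hRp _).2 (hmono n)
  have hDs : ∀ n, star (D n) = D n := fun n => (hDp n).isSelfAdjoint.star_eq
  have hDD : ∀ i j, i ≠ j → D i * D j = 0 := fun i j h =>
    increment_mul_increment (fun n => (hRp n).2) hmono h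
  have hpw : ∀ n, p n * (u n * t n * D n) = u n * t n * D n := fun n => by
    rw [mul_assoc (u n), ← htD n, mul_assoc (q n), ← mul_assoc (u n), ← mul_assoc (p n),
      ← mul_assoc (p n), hpq]
  have hwp : ∀ n, star (u n * t n * D n) * (u n * t n * D n) = D n := fun n => by
    have h1 : star (u n * t n) * (u n * t n) = 1 := (mul_mem (huu n) (htu n)).1
    rw [star_mul, mul_assoc, ← mul_assoc _ _ (D n), h1, one_mul, hDs, (hDp n).isIdempotentElem.eq]
  obtain ⟨V, hVA, hVw, hVV⟩ := exists_sum_partialIsometry (A := A)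
    (w := fun n => u n * t n * D n)
    (fun n => mul_mem (mul_mem (huA n) (htA n)) (sub_mem (hRp _).1 (hRp _).1))
    (fun n => (hwp n).symm ▸ hDp n)
    (fun i j h => by
      have h1 := congr(star $(hpw i))
      rw [star_mul, (hp i).2.isSelfAdjoint.star_eq] at h1
      rw [← h1, ← hpw j, mul_assoc, ← mul_assoc (p i), hpp i j h, zero_mul, mul_zero])
    (fun i j h => by
      rw [star_mul, mul_assoc, ← mul_assoc (D i), hDs, hDD i j h, zero_mul, mul_zero])
  simp only [hwp] at hVw hVV
  refine ⟨V, hVA, ?_, fun P hP => ?_⟩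
  · rw [hVV, projSup_increment rfl, hR, projSup_range_partialProjSup]
  · have h1 : P * V * projSup (Set.range D) = V * projSup (Set.range D) := by
      refine mul_projSup_congr ?_
      rintro _ ⟨n, rfl⟩
      rw [mul_assoc, hVw, ← hpw, ← mul_assoc, hP]
    have h2 : V * projSup (Set.range D) = V := by
      rw [← hVV]
      exact mul_star_mul_self (hVV ▸ isStarProjection_projSup _)
    rwa [mul_assoc, h2] at h1

/-! ### A subadditive weight on projections -/

/-- The value at `star p * p` of the sum of the vector functionals given by `x`. -/
noncomputable def weight (x : ℕ → H) (p : H →L[ℂ] H) : ENNReal := ∑' j, ‖p (x j)‖ₑ ^ 2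

/-- The supremum of `weight` over the unitary orbit of a projection. -/
noncomputable def maxWeight (A : VonNeumannAlgebra H) (x : ℕ → H) (p : H →L[ℂ] H) : ENNReal :=
  ⨆ u : {u : H →L[ℂ] H // u ∈ A ∧ u ∈ unitary (H →L[ℂ] H)}, weight (fun j => u.1 (x j)) p

theorem weight_le_maxWeight {A : VonNeumannAlgebra H} {u : H →L[ℂ] H} (hA : u ∈ A)
    (hu : u ∈ unitary (H →L[ℂ] H)) (x : ℕ → H) (p : H →L[ℂ] H) :
    weight (fun j => u (x j)) p ≤ maxWeight A x p :=
  le_iSup (fun u : {u : H →L[ℂ] H // u ∈ A ∧ u ∈ unitary (H →L[ℂ] H)} =>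
    weight (fun j => u.1 (x j)) p) ⟨u, hA, hu⟩

theorem norm_sq_apply_eq_add {p r : H →L[ℂ] H} (hp : IsStarProjection p) (hr : IsStarProjection r)
    (h : r * p = p) (y : H) : ‖r y‖ₑ ^ 2 = ‖p y‖ₑ ^ 2 + ‖(r - p) y‖ₑ ^ 2 := by
  have h0 : inner ℂ (p y) ((r - p) y) = 0 := by
    rw [← ContinuousLinearMap.adjoint_inner_right, ← ContinuousLinearMap.star_eq_adjoint,
      hp.isSelfAdjoint.star_eq, ← mul_apply_eq_comp, mul_sub, mul_eq_swap hr hp h,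
      hp.isIdempotentElem.eq, sub_self]
    simp
  have h1 := norm_add_sq_eq_norm_sq_add_norm_sq_of_inner_eq_zero _ _ h0
  have h2 : p y + (r - p) y = r y := by simp
  rw [h2] at h1
  simp only [← ofReal_norm, ← ENNReal.ofReal_pow (norm_nonneg _)]
  rw [← ENNReal.ofReal_add (by positivity) (by positivity)]
  congr 1
  nlinarith

theorem weight_eq_add {p r : H →L[ℂ] H} (hp : IsStarProjection p) (hr : IsStarProjection r)
    (h : r * p = p) (x : ℕ → H) : weight x r = weight x p + weight x (r - p) := by
  simp only [weight]
  rw [← ENNReal.tsum_add]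
  exact tsum_congr fun j => norm_sq_apply_eq_add hp hr h (x j)

theorem maxWeight_le_add {A : VonNeumannAlgebra H} {p r : H →L[ℂ] H} (hp : IsStarProjection p)
    (hr : IsStarProjection r) (h : r * p = p) (x : ℕ → H) :
    maxWeight A x r ≤ maxWeight A x p + maxWeight A x (r - p) := by
  refine iSup_le fun u => ?_
  rw [weight_eq_add hp hr h]
  exact add_le_add (weight_le_maxWeight u.2.1 u.2.2 x p) (weight_le_maxWeight u.2.1 u.2.2 x _)

/-- If `t` moves `d = p ∨ q - p` under `q`, then `d = d * star t * q * t`, so `‖d y‖ ≤ ‖q (t y)‖`.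
The factor `t` is absorbed by the supremum over unitaries. -/
theorem IsFinite.maxWeight_sup_sub_le [TopologicalSpace.SeparableSpace H]
    {A : VonNeumannAlgebra H} (hA : A.IsFinite) {p q : H →L[ℂ] H} (hp : p ∈ A.projections)
    (hq : q ∈ A.projections) (x : ℕ → H) :
    maxWeight A x (projSup {p, q} - p) ≤ maxWeight A x q := by
  obtain ⟨t, htA, htu, ht⟩ := hA.exists_unitary_sup_sub hp hq
  have hd : IsStarProjection (projSup {p, q} - p) :=
    isStarProjection_sub hp.2 (isStarProjection_projSup _) (projSup_mul_of_mem (by simp))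
  set d := projSup {p, q} - p
  have h1 : d = d * star t * q * t := by
    have h2 := congr(star $ht)
    simp only [star_mul, hd.isSelfAdjoint.star_eq, hq.2.isSelfAdjoint.star_eq] at h2
    rw [mul_assoc d, h2, mul_assoc, htu.1, mul_one]
  have h3 : ∀ y, ‖d y‖ₑ ≤ ‖q (t y)‖ₑ := fun y => by
    have h4 : ‖d * star t‖ ≤ 1 := by
      refine (norm_mul_le _ _).trans ?_
      have : ‖star t‖ ≤ 1 := by
        rw [norm_star]
        exact norm_le_one_of_star_mul_self (htu.1 ▸ .one _)
      exact mul_le_one₀ hd.norm_le (norm_nonneg _) this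
    have h5 : ‖(d * star t) (q (t y))‖ ≤ 1 * ‖q (t y)‖ := (d * star t).le_of_opNorm_le h4 _
    rw [one_mul] at h5
    have h6 : d y = (d * star t) (q (t y)) := congr($h1 y)
    rw [h6]
    exact enorm_le_iff_norm_le.2 h5
  refine iSup_le fun u => ?_
  refine le_trans ?_ (weight_le_maxWeight (mul_mem htA u.2.1) (mul_mem htu u.2.2) x q)
  exact ENNReal.tsum_le_tsum fun j => pow_le_pow_left' (h3 _) 2

theorem IsFinite.maxWeight_sup_le [TopologicalSpace.SeparableSpace H]
    {A : VonNeumannAlgebra H} (hA : A.IsFinite) {p q : H →L[ℂ] H} (hp : p ∈ A.projections)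
    (hq : q ∈ A.projections) (x : ℕ → H) :
    maxWeight A x (projSup {p, q}) ≤ maxWeight A x p + maxWeight A x q :=
  (maxWeight_le_add hp.2 (isStarProjection_projSup _) (projSup_mul_of_mem (by simp)) x).trans
    (add_le_add le_rfl (hA.maxWeight_sup_sub_le hp hq x))

/-- Pythagoras for the orthogonal increments, passed to the strong limit. -/
theorem enorm_sq_projSup {R : ℕ → H →L[ℂ] H} (hR : ∀ n, IsStarProjection (R n)) (h0 : R 0 = 0)
    (hmono : ∀ n, R (n + 1) * R n = R n) (y : H) :
    ‖projSup (Set.range R) y‖ₑ ^ 2 = ∑' n, ‖(R (n + 1) - R n) y‖ₑ ^ 2 := by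
  have h1 : ∀ n, ‖R n y‖ₑ ^ 2 = ∑ i ∈ Finset.range n, ‖(R (i + 1) - R i) y‖ₑ ^ 2 := by
    intro n
    induction n with
    | zero => simp [h0]
    | succ n ih =>
      rw [Finset.sum_range_succ, ← ih, norm_sq_apply_eq_add (hR n) (hR (n + 1)) (hmono n)]
  have h2 : Tendsto (fun n => ‖R n y‖ₑ ^ 2) atTop (𝓝 (‖projSup (Set.range R) y‖ₑ ^ 2)) :=
    ENNReal.Tendsto.pow ((continuous_enorm.tendsto _).comp (tendsto_projSup hR hmono y))
  simp only [h1] at h2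
  exact tendsto_nhds_unique h2 (ENNReal.tendsto_nat_tsum _)

/-- For each unitary the weight of the supremum is the sum of the weights of the increments of the
partial suprema, and each increment is dominated by the corresponding `q n`. -/
theorem IsFinite.maxWeight_projSup_le_tsum [TopologicalSpace.SeparableSpace H]
    {A : VonNeumannAlgebra H} (hA : A.IsFinite) {q : ℕ → H →L[ℂ] H}
    (hq : ∀ n, q n ∈ A.projections) (x : ℕ → H) :
    maxWeight A x (projSup (Set.range q)) ≤ ∑' n, maxWeight A x (q n) := by
  refine iSup_le fun u => ?_
  simp only [weight]
  rw [← projSup_range_partialProjSup]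
  simp only [enorm_sq_projSup (fun n => (partialProjSup_mem hq n).2) rfl
    (partialProjSup_succ_mul q)]
  rw [ENNReal.tsum_comm]
  refine ENNReal.tsum_le_tsum fun n => ?_
  exact (weight_le_maxWeight u.2.1 u.2.2 x _).trans
    (hA.maxWeight_sup_sub_le (partialProjSup_mem hq n) (hq n) x)

/-- Dominated convergence for the counting measure, with bound `‖x j‖ ^ 2`. -/
theorem tendsto_weight {E : Type*} [NormedAddCommGroup E] [InnerProductSpace ℂ E] {x : ℕ → E}
    (hx : weight x 1 ≠ ⊤) {T : ℕ → E →L[ℂ] E} {S : E →L[ℂ] E} (hT : ∀ n, ‖T n‖ ≤ 1)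
    (h : ∀ y, Tendsto (fun n => T n y) atTop (𝓝 (S y))) :
    Tendsto (fun n => weight x (T n)) atTop (𝓝 (weight x S)) := by
  simp only [weight, ← MeasureTheory.lintegral_count]
  refine MeasureTheory.tendsto_lintegral_of_dominated_convergence (fun j => ‖x j‖ₑ ^ 2)
    (fun n => measurable_of_countable _) (fun n => Eventually.of_forall fun j => ?_) ?_
    (Eventually.of_forall fun j => ?_)
  · refine pow_le_pow_left' (enorm_le_iff_norm_le.2 ?_) 2
    simpa using (T n).le_of_opNorm_le (hT n) (x j)
  · rw [MeasureTheory.lintegral_count]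
    simpa [weight] using hx
  · exact ENNReal.Tendsto.pow ((continuous_enorm.tendsto _).comp (h (x j)))

theorem enorm_unitary_apply {u : H →L[ℂ] H} (hu : u ∈ unitary (H →L[ℂ] H)) (y : H) :
    ‖u y‖ₑ = ‖y‖ₑ := by
  have := norm_apply_eq_of_star_mul_self_eq (S := u) (T := 1) (by rw [hu.1]; simp) y
  rw [← ofReal_norm, this, ← ofReal_norm]
  rfl

/-- Decreasing sequences of projections converge strongly. -/
theorem tendsto_of_antitone {P : ℕ → H →L[ℂ] H} (hP : ∀ n, IsStarProjection (P n))
    (hanti : ∀ n, P n * P (n + 1) = P (n + 1)) (y : H) :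
    Tendsto (fun n => P n y) atTop
      (𝓝 ((1 - projSup (Set.range fun n => 1 - P n) : H →L[ℂ] H) y)) := by
  have h1 := tendsto_projSup (R := fun n => 1 - P n) (fun n => (hP n).one_sub) (fun n => by
    exact one_sub_mul_one_sub (hP _) (hP _) (hanti n)) y
  simpa using h1.const_sub y

theorem one_sub_projSup_mem_projections {A : VonNeumannAlgebra H} {B : ℕ → H →L[ℂ] H}
    (hB : ∀ n, B n ∈ A.projections) :
    1 - projSup (Set.range fun n => 1 - B n) ∈ A.projections := by
  have := projSup_mem_projections (A := A) (S := Set.range fun n => 1 - B n) (by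
    rintro _ ⟨n, rfl⟩
    exact ⟨sub_mem (one_mem A) (hB n).1, (hB n).2.one_sub⟩)
  exact ⟨sub_mem (one_mem A) this.1, this.2.one_sub⟩

theorem mul_one_sub_projSup {B : ℕ → H →L[ℂ] H} (hB : ∀ n, IsStarProjection (B n)) (n : ℕ) :
    B n * (1 - projSup (Set.range fun n => 1 - B n)) =
      1 - projSup (Set.range fun n => 1 - B n) := by
  have h1 := one_sub_mul_one_sub (hB n).one_sub (isStarProjection_projSup _)
    (projSup_mul_of_mem (Set.mem_range_self (f := fun n => 1 - B n) n))
  rwa [sub_sub_cancel] at h1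

/-- Projections `q n` equivalent to subprojections of the successive differences of a sequence
decreasing to zero have upper limit zero. -/
theorem IsFinite.limsup_eq_zero [TopologicalSpace.SeparableSpace H]
    {A : VonNeumannAlgebra H} (hA : A.IsFinite) {g q u : ℕ → H →L[ℂ] H}
    (hg : ∀ n, g n ∈ A.projections) (hanti : ∀ n, g n * g (n + 1) = g (n + 1))
    (hsup : projSup (Set.range fun n => 1 - g n) = 1) (hq : ∀ n, q n ∈ A.projections)
    (huA : ∀ n, u n ∈ A) (huu : ∀ n, u n ∈ unitary (H →L[ℂ] H))
    (hgq : ∀ n, (g n - g (n + 1)) * u n * q n = u n * q n) :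
    1 - projSup (Set.range fun n => 1 - projSup (Set.range fun i => q (n + i))) = 0 := by
  have hBp : ∀ n, projSup (Set.range fun i => q (n + i)) ∈ A.projections :=
    fun n => projSup_mem_projections (by
      rintro _ ⟨i, rfl⟩
      exact hq _)
  have hQp := one_sub_projSup_mem_projections hBp
  have hBQ := mul_one_sub_projSup fun n => (hBp n).2
  have hgA : Antitone g := antitone_nat_of_succ_le fun n =>
    ((hg _).2.le_iff_mul_eq_right (hg n).2).2 (hanti n)
  have hle : ∀ {m n}, m ≤ n → g m * g n = g n := fun h =>
    ((hg _).2.le_iff_mul_eq_right (hg _).2).1 (hgA h)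
  have hpp : ∀ n, g n - g (n + 1) ∈ A.projections := fun n =>
    ⟨sub_mem (hg _).1 (hg _).1, isStarProjection_sub (hg _).2 (hg _).2 (hanti n)⟩
  have hporth : ∀ i j, i ≠ j → (g i - g (i + 1)) * (g j - g (j + 1)) = 0 := by
    intro i j hij
    have h1 := increment_mul_increment (E := fun n => 1 - g n)
      (fun n => (hg _).2.one_sub) (fun n => one_sub_mul_one_sub (hg _).2 (hg _).2 (hanti n)) hij
    simpa using h1
  have hgp : ∀ {i n}, n ≤ i → g n * (g i - g (i + 1)) = g i - g (i + 1) := fun {i n} h => by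
    rw [mul_sub, hle h, hle (h.trans i.le_succ)]
  refine hA.eq_zero_of_forall_subequiv hQp hg hanti hsup fun n => ?_
  obtain ⟨V, hVA, hVV, hPV⟩ := hA.exists_subequiv_projSup
    (p := fun i => g (n + i) - g (n + i + 1))
    (q := fun i => q (n + i)) (u := fun i => u (n + i)) (fun i => hpp _) (fun i => hq _)
    (fun i => huA _) (fun i => huu _) (fun i j h => hporth _ _ (by omega)) (fun i => hgq _)
  have h1 := hBQ n
  rw [← hVV] at h1
  -- The upper limit lies under the `n`-th tail supremum, which is the initial projection of `V`,
  -- while the range of `V` lies under `g n`. Restricting `V` gives the subequivalence.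
  refine ⟨V * _, mul_mem hVA hQp.1, ?_, ?_⟩
  · rw [star_mul, mul_assoc, ← mul_assoc (star V), h1, hQp.2.isSelfAdjoint.star_eq,
      hQp.2.isIdempotentElem.eq]
  · rw [← mul_assoc, hPV _ fun i => hgp (Nat.le_add_right n i)]

theorem conj_mem_projections {A : VonNeumannAlgebra H} {p u : H →L[ℂ] H}
    (hp : p ∈ A.projections) (huA : u ∈ A) (huu : u ∈ unitary (H →L[ℂ] H)) :
    star u * p * u ∈ A.projections := by
  refine ⟨mul_mem (mul_mem (star_mem huA) hp.1) huA, ?_, hp.2.isSelfAdjoint.conjugate' _⟩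
  change star u * p * u * (star u * p * u) = star u * p * u
  have h1 : star u * p * u * (star u * p * u) = star u * (p * (u * star u) * p) * u := by
    noncomm_ring
  rw [h1, huu.2, mul_one, hp.2.isIdempotentElem.eq]

/-- In a finite algebra, `maxWeight` is continuous along sequences decreasing to zero. -/
theorem IsFinite.exists_maxWeight_le [TopologicalSpace.SeparableSpace H]
    {A : VonNeumannAlgebra H} (hA : A.IsFinite) {x : ℕ → H} (hx : weight x 1 ≠ ⊤)
    {f : ℕ → H →L[ℂ] H} (hf : ∀ n, f n ∈ A.projections)
    (hanti : ∀ n, f n * f (n + 1) = f (n + 1)) (hsup : projSup (Set.range fun n => 1 - f n) = 1)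
    {ε : ENNReal} (hε : ε ≠ 0) : ∃ n, maxWeight A x (f n) ≤ ε := by
  by_contra! hcon
  have hfA : Antitone f := antitone_nat_of_succ_le fun n =>
    ((hf _).2.le_iff_mul_eq_right (hf n).2).2 (hanti n)
  have hle : ∀ {m n}, m ≤ n → f m * f n = f n := fun h =>
    ((hf _).2.le_iff_mul_eq_right (hf _).2).1 (hfA h)
  have hlim : ∀ y, Tendsto (fun n => f n y) atTop (𝓝 ((0 : H →L[ℂ] H) y)) := fun y => by
    simpa [hsup] using tendsto_of_antitone (fun n => (hf n).2) hanti y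
  -- For a single fixed unitary the weight of `f m` does tend to zero, so an excess over `ε` at `f
  -- k` is already visible on a block `f k - f m`.
  have hstep : ∀ k, ∃ m, k < m ∧ ∃ u ∈ A, u ∈ unitary (H →L[ℂ] H) ∧
      ε < weight (fun j => u (x j)) (f k - f m) := by
    intro k
    obtain ⟨⟨u, huA, huu⟩, hu⟩ := lt_iSup_iff.1 (hcon k)
    by_contra! hk
    have hux : weight (fun j => u (x j)) 1 ≠ ⊤ := by
      simpa [weight, enorm_unitary_apply huu] using hx
    have h1 := (tendsto_weight hux (fun n => (hf n).2.norm_le) hlim).add_const ε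
    have h2 : weight (fun j => u (x j)) 0 = 0 := by simp [weight]
    rw [h2, zero_add] at h1
    refine hu.not_ge (ge_of_tendsto h1 ?_)
    filter_upwards [eventually_gt_atTop k] with m hm
    rw [weight_eq_add (hf m).2 (hf k).2 (hle hm.le)]
    exact add_le_add le_rfl (hk m hm u huA huu)
  choose m hm u huA huu hu using hstep
  let κ : ℕ → ℕ := fun n => Nat.rec 0 (fun _ k => m k) n
  have hκs : ∀ n, κ (n + 1) = m (κ n) := fun n => rfl
  have hκ : StrictMono κ := strictMono_nat_of_lt_succ fun n => hm (κ n)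
  have hganti : ∀ n, f (κ n) * f (κ (n + 1)) = f (κ (n + 1)) := fun n => hle (hκ.monotone n.le_succ)
  have hgsup : projSup (Set.range fun n => 1 - f (κ n)) = 1 := by
    have h1 : projSup (Set.range fun n => 1 - f (κ n)) * projSup (Set.range fun n => 1 - f n) =
        projSup (Set.range fun n => 1 - f n) := by
      refine mul_projSup ?_
      rintro _ ⟨n, rfl⟩
      have hn : n ≤ κ n := hκ.id_le n
      simp only
      rw [← one_sub_mul_one_sub (hf _).2 (hf _).2 (hle hn), ← mul_assoc]
      congr 1
      exact projSup_mul_of_mem (Set.mem_range_self (f := fun n => 1 - f (κ n)) n)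
    rwa [hsup, mul_one] at h1
  have hpp : ∀ n, f (κ n) - f (κ (n + 1)) ∈ A.projections := fun n =>
    ⟨sub_mem (hf _).1 (hf _).1, isStarProjection_sub (hf _).2 (hf _).2 (hganti n)⟩
  -- Conjugating the blocks back makes all of them heavy for the same functional `weight x`.
  obtain ⟨q, hq⟩ : ∃ q : ℕ → H →L[ℂ] H,
    ∀ n, q n = star (u (κ n)) * (f (κ n) - f (κ (n + 1))) * u (κ n) := ⟨_, fun _ => rfl⟩
  have hqp : ∀ n, q n ∈ A.projections := fun n =>
    hq n ▸ conj_mem_projections (hpp n) (huA _) (huu _)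
  have hpq : ∀ n, (f (κ n) - f (κ (n + 1))) * u (κ n) * q n = u (κ n) * q n := by
    intro n
    have h1 : u (κ n) * q n = (f (κ n) - f (κ (n + 1))) * u (κ n) := by
      rw [hq, ← mul_assoc, ← mul_assoc, (huu _).2, one_mul]
    rw [mul_assoc, h1, ← mul_assoc, (hpp n).2.isIdempotentElem.eq]
  have hwq : ∀ n, ε < weight x (q n) := by
    intro n
    refine (hu (κ n)).trans_eq (tsum_congr fun j => ?_)
    rw [hq]
    change _ = ‖star (u (κ n)) ((f (κ n) - f (κ (n + 1))) (u (κ n) (x j)))‖ₑ ^ 2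
    rw [enorm_unitary_apply (Unitary.star_mem (huu _)), hκs]
  have hBp : ∀ n, projSup (Set.range fun i => q (n + i)) ∈ A.projections :=
    fun n => projSup_mem_projections (by
      rintro _ ⟨i, rfl⟩
      exact hqp _)
  have hBanti : ∀ n, projSup (Set.range fun i => q (n + i)) *
      projSup (Set.range fun i => q (n + 1 + i)) = projSup (Set.range fun i => q (n + 1 + i)) :=
    fun n => mul_projSup (by
      rintro _ ⟨i, rfl⟩
      have h1 : n + 1 + i = n + (i + 1) := by omega
      simp only [h1]
      exact projSup_mul_of_mem (Set.mem_range_self (f := fun i => q (n + i)) (i + 1)))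
  have hlimB := tendsto_of_antitone (fun n => (hBp n).2) hBanti
  rw [hA.limsup_eq_zero (fun n => hf (κ n)) hganti hgsup hqp (fun n => huA _) (fun n => huu _)
    hpq] at hlimB
  -- Each tail supremum dominates some `q n` and so has weight above `ε`; the tails decrease to the
  -- upper limit, which is zero.
  have hweight : ε ≤ weight x 0 := by
    refine ge_of_tendsto (tendsto_weight hx (fun n => (hBp n).2.norm_le) hlimB)
      (Eventually.of_forall fun n => ?_)
    refine (hwq n).le.trans ?_
    rw [weight_eq_add (hqp n).2 (hBp n).2
      (projSup_mul_of_mem (Set.mem_range_self (f := fun i => q (n + i)) 0))]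
    exact le_self_add
  simp [weight] at hweight
  exact hε hweight

/-! ### Spectral truncation -/

theorem cfc_mem {A : VonNeumannAlgebra H} {T : H →L[ℂ] H} (hT : T ∈ A) (f : ℝ → ℝ) :
    cfc f T ∈ A :=
  mem_of_forall_commutant fun a ha =>
    (Commute.cfc_real (show Commute T a from (commutant_mul_comm ha hT).symm) f).symm

theorem continuous_max_div {a b : ℝ} (h : a < b) :
    Continuous fun t : ℝ => max (t - b) 0 / max (t - a) (b - a) :=
  Continuous.div (by fun_prop) (by fun_prop) fun t =>
    (lt_max_of_lt_right (sub_pos.2 h)).ne'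

/-- The factorization puts the range of the higher truncation inside that of the lower one. Clamping
the denominator at `b - a` keeps the quotient continuous and changes nothing where `t ≥ b`. -/
theorem cfc_max_sub_eq_mul (T : H →L[ℂ] H) {a b : ℝ} (h : a < b) :
    cfc (fun t : ℝ => max (t - b) 0) T = cfc (fun t : ℝ => max (t - a) 0) T *
      cfc (fun t : ℝ => max (t - b) 0 / max (t - a) (b - a)) T := by
  rw [← cfc_mul _ _ T (by fun_prop) (continuous_max_div h).continuousOn]
  refine cfc_congr fun t _ => ?_
  rcases le_total t b with hb | hb
  · rw [max_eq_right (by linarith : t - b ≤ 0)]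
    simp
  · rw [max_eq_left (by linarith : (0 : ℝ) ≤ t - b), max_eq_left (by linarith : (0 : ℝ) ≤ t - a),
      max_eq_left (by linarith : b - a ≤ t - a), mul_div_cancel₀]
    linarith

theorem cfc_max_sub_zero {T : H →L[ℂ] H} (hT : 0 ≤ T) :
    cfc (fun t : ℝ => max (t - 0) 0) T = T := by
  conv_rhs => rw [← cfc_id ℝ T]
  refine cfc_congr fun t ht => ?_
  have := spectrum_nonneg_of_nonneg hT ht
  simp [this]

theorem norm_cfc_max_sub_sub_le {T : H →L[ℂ] H} (hT : 0 ≤ T) {c : ℝ} (hc : 0 ≤ c) :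
    ‖cfc (fun t : ℝ => max (t - c) 0) T - T‖ ≤ c := by
  have h1 : cfc (fun t : ℝ => max (t - c) 0) T - T = cfc (fun t : ℝ => max (t - c) 0 - t) T := by
    rw [cfc_sub _ _ T (by fun_prop) (by fun_prop), cfc_id' ℝ T]
  rw [h1]
  refine norm_cfc_le hc fun t ht => ?_
  have h0 : 0 ≤ t := spectrum_nonneg_of_nonneg hT ht
  rw [Real.norm_eq_abs, abs_le]
  rcases le_total t c with h | h
  · rw [max_eq_right (by linarith)]
    constructor <;> linarith
  · rw [max_eq_left (by linarith)]
    constructor <;> linarith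

/-- The function `(t - c) * (max (t - c) 0) ^ 2` is nonnegative. This bounds `T` below on the range
of the truncation without Borel spectral projections. -/
theorem re_inner_self_le_of_cfc {T : H →L[ℂ] H} (hT : IsSelfAdjoint T) (c : ℝ) (z : H) :
    c * ‖cfc (fun t : ℝ => max (t - c) 0) T z‖ ^ 2 ≤
      (inner ℂ (T (cfc (fun t : ℝ => max (t - c) 0) T z))
        (cfc (fun t : ℝ => max (t - c) 0) T z)).re := by
  set S := cfc (fun t : ℝ => max (t - c) 0) T with hS
  have hSs : IsSelfAdjoint S := cfc_predicate _ _
  have h1 : cfc (fun t : ℝ => max (t - c) 0 * ((t - c) * max (t - c) 0)) T =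
      S * ((T - c • (1 : H →L[ℂ] H)) * S) := by
    rw [cfc_mul _ _ T (by fun_prop) (by fun_prop), cfc_mul _ _ T (by fun_prop) (by fun_prop),
      cfc_sub _ _ T (by fun_prop) (by fun_prop), cfc_id' ℝ T, cfc_const c T, ← hS,
      Algebra.algebraMap_eq_smul_one]
  have h2 : 0 ≤ S * ((T - c • (1 : H →L[ℂ] H)) * S) := by
    rw [← h1]
    refine cfc_nonneg fun t _ => ?_
    rcases le_total t c with h | h
    · rw [max_eq_right (by linarith)]; simp
    · rw [max_eq_left (by linarith)]
      have : 0 ≤ t - c := by linarith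
      positivity
  have h3 := ((ContinuousLinearMap.nonneg_iff_isPositive _).1 h2).re_inner_nonneg_left z
  have h4 : inner ℂ ((S * ((T - c • (1 : H →L[ℂ] H)) * S)) z) z =
      inner ℂ (T (S z)) (S z) - c * inner ℂ (S z) (S z) := by
    rw [mul_apply_eq_comp]
    nth_rewrite 1 [← hSs.star_eq]
    rw [ContinuousLinearMap.star_eq_adjoint, ContinuousLinearMap.adjoint_inner_left]
    simp only [mul_apply_eq_comp, sub_apply, smul_apply,
      one_apply_eq_self, inner_sub_left]
    rw [RCLike.real_smul_eq_coe_smul (K := ℂ) c (S z), inner_smul_left, RCLike.conj_ofReal]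
    rfl
  rw [h4, inner_self_eq_norm_sq_to_K] at h3
  have h5 : ((c : ℂ) * ((‖S z‖ : ℂ)) ^ 2).re = c * ‖S z‖ ^ 2 := by
    norm_cast
  simp only [map_sub, RCLike.re_to_complex, Complex.coe_algebraMap] at h3
  rw [h5] at h3
  linarith

theorem norm_mul_projSup_lt_one {p S : H →L[ℂ] H} {c : ℝ} (hc : 0 < c) (hc1 : c ≤ 1)
    (h : ∀ z, ‖p (S z)‖ ^ 2 ≤ (1 - c) * ‖S z‖ ^ 2) : ‖p * projSup {S}‖ < 1 := by
  have h1 : ∀ y, ‖p (projSup {S} y)‖ ^ 2 ≤ (1 - c) * ‖projSup {S} y‖ ^ 2 := by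
    intro y
    have hy : projSup {S} y ∈
        (⨆ p ∈ ({S} : Set (H →L[ℂ] H)), LinearMap.range (p : H →ₗ[ℂ] H)).topologicalClosure :=
      Submodule.starProjection_apply_mem _ _
    rw [iSup_singleton, ← SetLike.mem_coe, Submodule.topologicalClosure_coe] at hy
    have hcl : IsClosed {y : H | ‖p y‖ ^ 2 ≤ (1 - c) * ‖y‖ ^ 2} :=
      isClosed_le (by fun_prop) (by fun_prop)
    refine closure_minimal ?_ hcl hy
    rintro _ ⟨z, rfl⟩
    exact h z
  refine lt_of_le_of_lt (ContinuousLinearMap.opNorm_le_bound _ (Real.sqrt_nonneg (1 - c))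
    fun y => ?_) ?_
  · refine (pow_le_pow_iff_left₀ (norm_nonneg _) (by positivity) two_ne_zero).1 ?_
    rw [mul_pow, Real.sq_sqrt (by linarith)]
    refine (h1 y).trans (mul_le_mul_of_nonneg_left ?_ (by linarith))
    refine pow_le_pow_left₀ (norm_nonneg _) ?_ 2
    simpa using (projSup {S}).le_of_opNorm_le (isStarProjection_projSup {S}).norm_le y
  · rw [Real.sqrt_lt' one_pos]
    linarith

/-- If `p, q` are projections, then `p ∨ q` is the supremum of an increasing sequence `p ∨ g n`
with `g n ≤ q` and `‖p * g n‖ < 1`. -/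
theorem exists_truncation {A : VonNeumannAlgebra H} {p q : H →L[ℂ] H} (hp : p ∈ A.projections)
    (hq : q ∈ A.projections) :
    ∃ g : ℕ → H →L[ℂ] H, (∀ n, g n ∈ A.projections) ∧ (∀ n, q * g n = g n) ∧
      (∀ n, ‖p * g n‖ < 1) ∧ (∀ n, g (n + 1) * g n = g n) ∧
      projSup (Set.range fun n => projSup {p, g n}) = projSup {p, q} := by
  have hps : star p = p := hp.2.isSelfAdjoint.star_eq
  have hqs : star q = q := hq.2.isSelfAdjoint.star_eq
  have hpp : p * p = p := hp.2.isIdempotentElem.eq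
  have hqq : q * q = q := hq.2.isIdempotentElem.eq
  -- On the range of `q` the form of `T` is `‖z‖ ^ 2 - ‖p z‖ ^ 2`, so a lower bound `c` for `T`
  -- means an angle to `p` bounded away from zero.
  set T := q * (1 - p) * q with hT
  have hTA : T ∈ A := mul_mem (mul_mem hq.1 (sub_mem (one_mem A) hp.1)) hq.1
  have hT0 : 0 ≤ T := by
    have h1 : T = star ((1 - p) * q) * ((1 - p) * q) := by
      rw [star_mul, hqs, hp.2.one_sub.isSelfAdjoint.star_eq, mul_assoc, ← mul_assoc (1 - p),
        hp.2.one_sub.isIdempotentElem.eq, ← mul_assoc]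
    rw [h1]
    exact star_mul_self_nonneg _
  have hTs : IsSelfAdjoint T := hT0.isSelfAdjoint
  have hqT : q * T = T := by rw [hT, ← mul_assoc, ← mul_assoc, hqq]
  obtain ⟨c, hanti, hc, hlim⟩ := exists_seq_strictAnti_tendsto' (zero_lt_one (α := ℝ))
  set S : ℕ → H →L[ℂ] H := fun n => cfc (fun t : ℝ => max (t - c n) 0) T with hS
  have hqS : ∀ n, q * S n = S n := fun n => by
    simp only [hS]
    rw [cfc_max_sub_eq_mul T (hc n).1, cfc_max_sub_zero hT0, ← mul_assoc, hqT]
  have hgp : ∀ n, projSup {S n} ∈ A.projections := fun n =>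
    ⟨projSup_mem (by simpa using cfc_mem hTA _), isStarProjection_projSup _⟩
  have hqg : ∀ n, q * projSup {S n} = projSup {S n} := fun n => mul_projSup (by simpa using hqS n)
  refine ⟨fun n => projSup {S n}, hgp, hqg, fun n => ?_, fun n => ?_, ?_⟩
  · refine norm_mul_projSup_lt_one (hc n).1 (hc n).2.le fun z => ?_
    have h1 := re_inner_self_le_of_cfc hTs (c n) z
    have hqz : q (S n z) = S n z := congr($(hqS n) z)
    have h2 : inner ℂ (T (S n z)) (S n z) =
        ((‖S n z‖ ^ 2 - ‖p (S n z)‖ ^ 2 : ℝ) : ℂ) := by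
      have h3 : T (S n z) = q (S n z - p (S n z)) := by
        change q ((1 - p) (q (S n z))) = _
        rw [hqz]
        simp
      have h4 : inner ℂ (p (S n z)) (S n z) = inner ℂ (p (S n z)) (p (S n z)) := by
        conv_rhs => rw [← ContinuousLinearMap.adjoint_inner_left,
          ← ContinuousLinearMap.star_eq_adjoint, hps, ← mul_apply_eq_comp, hpp]
      rw [h3]
      nth_rewrite 1 [← hqs]
      rw [ContinuousLinearMap.star_eq_adjoint, ContinuousLinearMap.adjoint_inner_left, hqz,
        inner_sub_left, h4, inner_self_eq_norm_sq_to_K, inner_self_eq_norm_sq_to_K]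
      simp
    rw [show cfc (fun t : ℝ => max (t - c n) 0) T = S n from rfl, h2, Complex.ofReal_re] at h1
    linarith
  · refine mul_projSup fun r hr => ?_
    rw [Set.mem_singleton_iff.1 hr]
    have h1 := cfc_max_sub_eq_mul T (hanti (Nat.lt_succ_self n))
    change S n = S (n + 1) * _ at h1
    rw [h1, ← mul_assoc, projSup_mul_of_mem (Set.mem_singleton _)]
  · set X := projSup (Set.range fun n => projSup {p, projSup {S n}}) with hX
    have hXp' : IsStarProjection X := isStarProjection_projSup _
    have hXn : ∀ n, X * projSup {p, projSup {S n}} = projSup {p, projSup {S n}} := fun n =>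
      projSup_mul_of_mem ⟨n, rfl⟩
    have hXp : X * p = p := by
      have h1 : projSup {p, projSup {S 0}} * p = p := projSup_mul_of_mem (by simp)
      rw [← h1, ← mul_assoc, hXn]
    have hXS : ∀ n, X * S n = S n := fun n => by
      have h1 : projSup {p, projSup {S n}} * projSup {S n} = projSup {S n} :=
        projSup_mul_of_mem (by simp)
      have h2 : projSup {S n} * S n = S n := projSup_mul_of_mem (Set.mem_singleton _)
      rw [← h2, ← mul_assoc, ← h1, ← mul_assoc, hXn]
    have hST : Tendsto S atTop (𝓝 T) := by
      rw [tendsto_iff_norm_sub_tendsto_zero]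
      exact squeeze_zero (fun _ => norm_nonneg _)
        (fun n => norm_cfc_max_sub_sub_le hT0 (hc n).1.le) hlim
    have hXT : X * T = T := by
      have h1 := hST.const_mul X
      simp only [hXS] at h1
      exact tendsto_nhds_unique h1 hST
    have hYp : (1 - X) * p = 0 := by rw [sub_mul, one_mul, hXp, sub_self]
    have hYT : (1 - X) * T = 0 := by rw [sub_mul, one_mul, hXT, sub_self]
    have hYs : star (1 - X) = 1 - X := hXp'.one_sub.isSelfAdjoint.star_eq
    -- Since `X` fixes `T`, the compression of `T` to `1 - X` vanishes, so `q * (1 - X)` has range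
    -- under `p ≤ X`. This leaves `q * (1 - X) = 0`.
    have h1 : (1 - p) * (q * (1 - X)) = 0 := by
      refine (CStarRing.star_mul_self_eq_zero_iff _).1 ?_
      have : star ((1 - p) * (q * (1 - X))) * ((1 - p) * (q * (1 - X))) =
          (1 - X) * (q * ((1 - p) * (1 - p)) * q) * (1 - X) := by
        simp only [star_mul, hYs, hqs, hp.2.one_sub.isSelfAdjoint.star_eq, mul_assoc]
      rw [this, hp.2.one_sub.isIdempotentElem.eq, ← hT, hYT, zero_mul]
    have h2 : q * (1 - X) = 0 := by
      refine (CStarRing.star_mul_self_eq_zero_iff _).1 ?_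
      have h3 : q * (1 - X) = p * (q * (1 - X)) := by
        rwa [sub_mul, one_mul, sub_eq_zero] at h1
      rw [star_mul, hYs, hqs, mul_assoc, ← mul_assoc q q, hqq, h3, ← mul_assoc, hYp, zero_mul]
    have hXq : X * q = q := by
      have h3 := congr(star $h2)
      rw [star_mul, hYs, hqs, star_zero, sub_mul, one_mul, sub_eq_zero] at h3
      exact h3.symm
    refine eq_of_mul_eq hXp' (isStarProjection_projSup _) (mul_projSup ?_) (mul_projSup ?_)
    · rintro _ (rfl | rfl)
      exacts [hXp, hXq]
    · rintro _ ⟨n, rfl⟩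
      refine mul_projSup ?_
      rintro _ (rfl | rfl)
      · exact projSup_mul_of_mem (by simp)
      · have h3 : projSup {p, q} * q = q := projSup_mul_of_mem (by simp)
        rw [← hqg n, ← mul_assoc, h3]

/-! ### Exhaustion by elements of an ideal of projections -/

/-- Continuity at zero applied to the differences `r - h n`, whose complements have supremum `1`. -/
theorem IsFinite.exists_maxWeight_projSup_sub_le [TopologicalSpace.SeparableSpace H]
    {A : VonNeumannAlgebra H} (hA : A.IsFinite) {x : ℕ → H} (hx : weight x 1 ≠ ⊤)
    {h : ℕ → H →L[ℂ] H} (hh : ∀ n, h n ∈ A.projections)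
    (hmono : ∀ n, h (n + 1) * h n = h n) {ε : ENNReal} (hε : ε ≠ 0) :
    ∃ n, maxWeight A x (projSup (Set.range h) - h n) ≤ ε := by
  set r := projSup (Set.range h) with hr
  have hrp : r ∈ A.projections := projSup_mem_projections (by
    rintro _ ⟨n, rfl⟩
    exact hh n)
  have hrr : r * r = r := hrp.2.isIdempotentElem.eq
  have hrh : ∀ n, r * h n = h n := fun n => projSup_mul_of_mem ⟨n, rfl⟩
  have hhr : ∀ n, h n * r = h n := fun n => mul_eq_swap hrp.2 (hh n).2 (hrh n)
  have hhh : ∀ n, h n * h n = h n := fun n => (hh n).2.isIdempotentElem.eq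
  refine hA.exists_maxWeight_le hx (fun n => ⟨sub_mem hrp.1 (hh n).1,
    isStarProjection_sub (hh n).2 hrp.2 (hrh n)⟩) (fun n => ?_) ?_ hε
  · rw [mul_sub, sub_mul, sub_mul, hrr, hrh, hhr, mul_eq_swap (hh _).2 (hh _).2 (hmono n)]
    abel
  · set X := projSup (Set.range fun n => 1 - (r - h n)) with hX
    have hXn : ∀ n, X * (1 - (r - h n)) = 1 - (r - h n) := fun n => projSup_mul_of_mem ⟨n, rfl⟩
    have hXh : ∀ n, X * h n = h n := fun n => by
      have h1 : (1 - (r - h n)) * h n = h n := by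
        rw [sub_mul, sub_mul, one_mul, hrh, hhh, sub_self, sub_zero]
      rw [← h1, ← mul_assoc, hXn]
    have hXr : X * r = r := mul_projSup (by
      rintro _ ⟨n, rfl⟩
      exact hXh n)
    have h1 := hXn 0
    rw [mul_sub, mul_sub, hXr, hXh, mul_one] at h1
    exact sub_left_injective h1

theorem IsProjectionIdeal.zero_mem {A : VonNeumannAlgebra H} {M : Set (H →L[ℂ] H)}
    (hM : A.IsProjectionIdeal M) : 0 ∈ M := by
  obtain ⟨q, hq⟩ := hM.nonempty
  exact hM.mem_of_le 0 ⟨ZeroMemClass.zero_mem A, .zero _⟩ q hq (hM.subset_projections hq).2.nonneg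

/-- An ideal of projections contains a sequence with supremum `1`. -/
theorem IsProjectionIdeal.exists_seq [TopologicalSpace.SeparableSpace H]
    {A : VonNeumannAlgebra H} {M : Set (H →L[ℂ] H)} (hM : A.IsProjectionIdeal M) :
    ∃ p : ℕ → H →L[ℂ] H, (∀ n, p n ∈ M) ∧ projSup (Set.range p) = 1 := by
  -- A countable dense subset of the union of the ranges is chosen; one projection of `M` for each
  -- of its points suffices.
  let D : Set H := {y | ∃ q ∈ M, q y = y}
  obtain ⟨c, hcD, hc, hDc⟩ :=
    (TopologicalSpace.IsSeparable.of_separableSpace D).exists_countable_dense_subset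
  have hne : c.Nonempty := by
    rw [Set.nonempty_iff_ne_empty]
    rintro rfl
    obtain ⟨q, hq⟩ := hM.nonempty
    have : (0 : H) ∈ closure (∅ : Set H) := hDc ⟨q, hq, map_zero q⟩
    simp at this
  obtain ⟨s, rfl⟩ := hc.exists_eq_range hne
  choose p hpM hps using fun n => hcD (Set.mem_range_self n)
  refine ⟨p, hpM, ?_⟩
  have h1 : projSup (Set.range p) * projSup M = projSup M := by
    refine mul_projSup fun q hq => ?_
    ext y
    have hcl : IsClosed {z : H | projSup (Set.range p) z = z} :=
      isClosed_eq (by fun_prop) continuous_id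
    have hy : q y ∈ closure (Set.range s) :=
      hDc ⟨q, hq, congr($((hM.subset_projections hq).2.isIdempotentElem.eq) y)⟩
    refine closure_minimal ?_ hcl hy
    rintro _ ⟨n, rfl⟩
    have h2 : projSup (Set.range p) * p n = p n := projSup_mul_of_mem (Set.mem_range_self n)
    change projSup (Set.range p) (s n) = s n
    rw [← hps n]
    exact congr($h2 (s n))
  rwa [hM.projSup_eq_one, mul_one] at h1

/-- If `P` is approximated from below by elements of the ideal with respect to `maxWeight` and
`q` belongs to the ideal, then `P ∨ q` is approximated as well. -/
theorem IsProjectionIdeal.approx_sup [TopologicalSpace.SeparableSpace H]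
    {A : VonNeumannAlgebra H} (hA : A.IsFinite) {M : Set (H →L[ℂ] H)}
    (hM : A.IsProjectionIdeal M) {x : ℕ → H} (hx : weight x 1 ≠ ⊤) {P q f : H →L[ℂ] H}
    (hP : P ∈ A.projections) (hq : q ∈ M) (hf : f ∈ M) (hPf : P * f = f) {ε : ENNReal}
    (hε : ε ≠ 0) :
    ∃ k ∈ M, projSup {P, q} * k = k ∧
      maxWeight A x (projSup {P, q} - k) ≤ maxWeight A x (P - f) + ε := by
  have hqp := hM.subset_projections hq
  have hfp := hM.subset_projections hf
  -- The truncation is taken relative to `f`, since `P` need not belong to `M`.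
  obtain ⟨g, hg, hqg, hlt, hgmono, hsup⟩ := exists_truncation hfp hqp
  have hgM : ∀ n, g n ∈ M := fun n =>
    hM.mem_of_le _ (hg n) q hq (((hg n).2.le_iff_mul_eq_right hqp.2).2 (hqg n))
  have hkM : ∀ n, projSup {f, g n} ∈ M := fun n => hM.sup_mem f hf _ (hgM n) (hlt n)
  obtain ⟨n, hn⟩ := hA.exists_maxWeight_projSup_sub_le hx
    (h := fun n => projSup {f, g n}) (fun n => hM.subset_projections (hkM n)) (fun n => by
      refine mul_projSup ?_
      have h1 : projSup {f, g (n + 1)} * g (n + 1) = g (n + 1) := projSup_mul_of_mem (by simp)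
      rintro _ (rfl | rfl)
      · exact projSup_mul_of_mem (by simp)
      · rw [← hgmono n, ← mul_assoc, h1]) hε
  rw [hsup] at hn
  set k := projSup {f, g n} with hk
  set r := projSup {f, q} with hr
  set a := projSup {P, q} with ha
  have hkp : k ∈ A.projections := hM.subset_projections (hkM n)
  have hrp : r ∈ A.projections := projSup_mem_projections (by
    rintro _ (rfl | rfl)
    exacts [hfp, hqp])
  have haP : a * P = P := projSup_mul_of_mem (by simp)
  have haq : a * q = q := projSup_mul_of_mem (by simp)
  have haf : a * f = f := by rw [← hPf, ← mul_assoc, haP]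
  have har : a * r = r := mul_projSup (by
    rintro _ (rfl | rfl)
    exacts [haf, haq])
  have hrk : r * k = k := mul_projSup (by
    have h1 : r * q = q := projSup_mul_of_mem (by simp)
    rintro _ (rfl | rfl)
    · exact projSup_mul_of_mem (by simp)
    · rw [← hqg n, ← mul_assoc, h1])
  have hak : a * k = k := by rw [← hrk, ← mul_assoc, har]
  have hPfp : P - f ∈ A.projections :=
    ⟨sub_mem hP.1 hfp.1, isStarProjection_sub hfp.2 hP.2 hPf⟩
  have hrkp : r - k ∈ A.projections :=
    ⟨sub_mem hrp.1 hkp.1, isStarProjection_sub hkp.2 hrp.2 hrk⟩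
  have hbp : projSup {P - f, r - k} ∈ A.projections := projSup_mem_projections (by
    rintro _ (rfl | rfl)
    exacts [hPfp, hrkp])
  -- Passing from `k` to `P ∨ q` costs only the two errors `P - f` and `f ∨ q - k`, by
  -- subadditivity.
  have hab : projSup {k, projSup {P - f, r - k}} = a := by
    set b := projSup {P - f, r - k} with hb
    have hZk : projSup {k, b} * k = k := projSup_mul_of_mem (by simp)
    have hZb : projSup {k, b} * b = b := projSup_mul_of_mem (by simp)
    have hbP : b * (P - f) = P - f := projSup_mul_of_mem (by simp)
    have hbr : b * (r - k) = r - k := projSup_mul_of_mem (by simp)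
    have hZr : projSup {k, b} * r = r := by
      have h1 : projSup {k, b} * (r - k) = r - k := by rw [← hbr, ← mul_assoc, hZb]
      rw [mul_sub, hZk] at h1
      exact sub_left_injective h1
    have hrf : r * f = f := projSup_mul_of_mem (by simp)
    have hrq : r * q = q := projSup_mul_of_mem (by simp)
    have hZf : projSup {k, b} * f = f := by rw [← hrf, ← mul_assoc, hZr]
    have hZq : projSup {k, b} * q = q := by rw [← hrq, ← mul_assoc, hZr]
    have hZP : projSup {k, b} * P = P := by
      have h1 : projSup {k, b} * (P - f) = P - f := by rw [← hbP, ← mul_assoc, hZb]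
      rw [mul_sub, hZf] at h1
      exact sub_left_injective h1
    refine eq_of_mul_eq (isStarProjection_projSup _) (isStarProjection_projSup _)
      (mul_projSup ?_) (mul_projSup ?_)
    · rintro _ (rfl | rfl)
      exacts [hZP, hZq]
    · rintro _ (rfl | rfl)
      · exact hak
      · refine mul_projSup ?_
        rintro _ (rfl | rfl)
        · rw [mul_sub, haP, haf]
        · rw [mul_sub, har, hak]
  refine ⟨k, hkM n, hak, ?_⟩
  have h1 := hA.maxWeight_sup_sub_le hkp hbp x
  rw [hab] at h1
  exact h1.trans ((hA.maxWeight_sup_le hPfp hrkp x).trans (add_le_add le_rfl hn))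

/-- Half of `ε` pays for stopping at a finite supremum `P` of elements of `M`, the other half for an
`f ∈ M` below `P`. The induction ranges over all tolerances because each step halves the one it
passes on. -/
theorem IsProjectionIdeal.exists_maxWeight_one_sub_le [TopologicalSpace.SeparableSpace H]
    {A : VonNeumannAlgebra H} (hA : A.IsFinite) {M : Set (H →L[ℂ] H)}
    (hM : A.IsProjectionIdeal M) {x : ℕ → H} (hx : weight x 1 ≠ ⊤) {ε : ENNReal} (hε : ε ≠ 0) :
    ∃ f ∈ M, maxWeight A x (1 - f) ≤ ε := by
  obtain ⟨p, hpM, hp⟩ := hM.exists_seq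
  have hPp := partialProjSup_mem fun n => hM.subset_projections (hpM n)
  have happrox : ∀ n, ∀ δ : ENNReal, δ ≠ 0 → ∃ f ∈ M, partialProjSup p n * f = f ∧
      maxWeight A x (partialProjSup p n - f) ≤ δ := by
    intro n
    induction n with
    | zero =>
      refine fun δ _ => ⟨0, hM.zero_mem, mul_zero _, ?_⟩
      simp [partialProjSup, maxWeight, weight]
    | succ n ih =>
      intro δ hδ
      have hδ2 : δ / 2 ≠ 0 := (ENNReal.half_pos hδ).ne'
      obtain ⟨f, hf, hPf, hle⟩ := ih (δ / 2) hδ2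
      obtain ⟨k, hk, hPk, hle'⟩ := hM.approx_sup hA hx (hPp n) (hpM n) hf hPf hδ2
      exact ⟨k, hk, hPk, hle'.trans ((add_le_add hle le_rfl).trans_eq (ENNReal.add_halves δ))⟩
  have hε2 : ε / 2 ≠ 0 := (ENNReal.half_pos hε).ne'
  obtain ⟨n, hn⟩ := hA.exists_maxWeight_projSup_sub_le hx hPp (partialProjSup_succ_mul p) hε2
  rw [projSup_range_partialProjSup, hp] at hn
  obtain ⟨f, hf, hPf, hle⟩ := happrox n (ε / 2) hε2
  have hfp := hM.subset_projections hf
  refine ⟨f, hf, ?_⟩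
  have h1 := maxWeight_le_add (A := A) (isStarProjection_sub hfp.2 (hPp n).2 hPf) hfp.2.one_sub
    (by
      rw [sub_mul, one_mul, mul_sub, mul_eq_swap (hPp n).2 hfp.2 hPf, hfp.2.isIdempotentElem.eq,
        sub_self, sub_zero]) x
  rw [sub_sub_sub_cancel_right] at h1
  exact h1.trans ((add_le_add hle hn).trans_eq (ENNReal.add_halves ε))

/-- A separable Hilbert space carries a finite and faithful sum of vector functionals. -/
theorem exists_faithful_weight (H : Type*) [NormedAddCommGroup H] [InnerProductSpace ℂ H]
    [TopologicalSpace.SeparableSpace H] :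
    ∃ x : ℕ → H, weight x 1 ≠ ⊤ ∧ ∀ Q : H →L[ℂ] H, weight x Q = 0 → Q = 0 := by
  set y := TopologicalSpace.denseSeq H
  obtain ⟨δ, hδ, hsum⟩ := ENNReal.exists_pos_sum_of_countable (ε := 1) one_ne_zero ℕ
  -- Scaling by `c j` makes the squared norm at most `δ j`; nonzero multiples of a dense sequence
  -- still detect every nonzero operator.
  let c : ℕ → ℝ := fun j => Real.sqrt (δ j) / (1 + ‖y j‖)
  have hc : ∀ j, 0 < c j := fun j => by
    have := hδ j
    have : 0 < Real.sqrt (δ j) := Real.sqrt_pos.2 (by exact_mod_cast this)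
    positivity
  refine ⟨fun j => (c j : ℂ) • y j, (lt_of_le_of_lt ?_ (hsum.trans ENNReal.one_lt_top)).ne,
    fun Q hQ => ?_⟩
  · refine ENNReal.tsum_le_tsum fun j => ?_
    have h1 : ‖(c j : ℂ) • y j‖ ^ 2 ≤ δ j := by
      rw [norm_smul, Complex.norm_real, Real.norm_of_nonneg (hc j).le, div_mul_eq_mul_div, div_pow,
        mul_pow, Real.sq_sqrt (NNReal.coe_nonneg (δ j)), div_le_iff₀ (by positivity)]
      refine mul_le_mul_of_nonneg_left ?_ (NNReal.coe_nonneg (δ j))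
      exact pow_le_pow_left₀ (norm_nonneg _) (by linarith) 2
    rw [← ENNReal.ofReal_coe_nnreal, one_apply_eq_self, ← ofReal_norm,
      ← ENNReal.ofReal_pow (norm_nonneg _)]
    exact ENNReal.ofReal_le_ofReal h1
  · have h0 : ∀ j, Q (y j) = 0 := by
      intro j
      have h1 := ENNReal.tsum_eq_zero.1 hQ j
      have h2 : Q ((c j : ℂ) • y j) = 0 := by simpa using h1
      rw [map_smul, smul_eq_zero] at h2
      exact h2.resolve_left (Complex.ofReal_ne_zero.2 (hc j).ne')
    refine DFunLike.coe_injective ((TopologicalSpace.denseRange_denseSeq H).equalizer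
      Q.continuous (0 : H →L[ℂ] H).continuous (funext h0))

end VonNeumannAlgebra

/-! ### Infima of tails of good approximants -/

open VonNeumannAlgebra in
theorem proposition1 {H : Type*} [NormedAddCommGroup H] [InnerProductSpace ℂ H]
    [CompleteSpace H] [TopologicalSpace.SeparableSpace H]
    (A : VonNeumannAlgebra H) (hA : A.IsFinite)
    (M : Set (H →L[ℂ] H)) (hM : A.IsProjectionIdeal M) :
    ∃ e : ℕ → H →L[ℂ] H, (∀ n, e n ∈ M) ∧ VonNeumannAlgebra.IncreasesTo e 1 := by
  obtain ⟨x, hx, hfaithful⟩ := exists_faithful_weight H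
  obtain ⟨δ, hδ, hsum⟩ := ENNReal.exists_pos_sum_of_countable (ε := 1) one_ne_zero ℕ
  choose F hF hFδ using fun n => hM.exists_maxWeight_one_sub_le hA hx
    (ε := δ n) (by exact_mod_cast (hδ n).ne')
  have hFp : ∀ n, F n ∈ A.projections := fun n => hM.subset_projections (hF n)
  have hFc : ∀ n, 1 - F n ∈ A.projections := fun n =>
    ⟨sub_mem (one_mem A) (hFp n).1, (hFp n).2.one_sub⟩
  -- This is the infimum of the `F i` with `i ≥ n`. It lies under `F n`, hence in `M`, and its
  -- complement has `maxWeight` at most the `n`-th tail of `∑ δ i`.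
  obtain ⟨e, he⟩ : ∃ e : ℕ → H →L[ℂ] H,
    ∀ n, e n = 1 - projSup (Set.range fun i => 1 - F (i + n)) := ⟨_, fun _ => rfl⟩
  have hep : ∀ n, e n ∈ A.projections := fun n =>
    he n ▸ one_sub_projSup_mem_projections fun i => hFp (i + n)
  have hFe : ∀ n, F n * e n = e n := fun n => by
    rw [he]
    simpa using mul_one_sub_projSup (fun i => (hFp (i + n)).2) 0
  have hee : ∀ n, e (n + 1) * e n = e n := fun n => by
    rw [he, he]
    refine one_sub_mul_one_sub (isStarProjection_projSup _) (isStarProjection_projSup _)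
      (mul_projSup ?_)
    rintro _ ⟨i, rfl⟩
    have h1 : i + (n + 1) = i + 1 + n := by omega
    simp only [h1]
    exact projSup_mul_of_mem (Set.mem_range_self (f := fun i => 1 - F (i + n)) (i + 1))
  have hsmall : ∀ n, weight x (1 - projSup (Set.range e)) ≤ ∑' i, (δ (i + n) : ENNReal) := by
    intro n
    have h1 : maxWeight A x (1 - e n) ≤ ∑' i, (δ (i + n) : ENNReal) := by
      rw [he, sub_sub_cancel]
      exact (hA.maxWeight_projSup_le_tsum (fun i => hFc (i + n)) x).trans
        (ENNReal.tsum_le_tsum fun i => hFδ (i + n))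
    refine le_trans ?_ ((weight_le_maxWeight (one_mem A) (one_mem _) x (1 - e n)).trans h1)
    have h2 : (1 - e n) * (1 - projSup (Set.range e)) = 1 - projSup (Set.range e) :=
      one_sub_mul_one_sub (hep n).2 (isStarProjection_projSup _)
        (projSup_mul_of_mem (Set.mem_range_self n))
    have h3 := weight_eq_add (isStarProjection_projSup _).one_sub (hep n).2.one_sub h2 x
    simp only [one_apply_eq_self]
    rw [h3]
    exact le_self_add
  have hsup : projSup (Set.range e) = 1 := by
    have h1 : weight x (1 - projSup (Set.range e)) = 0 := le_antisymm
      (ge_of_tendsto' (ENNReal.tendsto_sum_nat_add (fun i => (δ i : ENNReal))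
        (hsum.trans ENNReal.one_lt_top).ne) hsmall) zero_le
    exact (sub_eq_zero.1 (hfaithful _ h1)).symm
  refine ⟨e, fun n => hM.mem_of_le _ (hep n) _ (hF n)
    (((hep n).2.le_iff_mul_eq_right (hFp n).2).2 (hFe n)), ?_, hsup, fun y => ?_⟩
  · exact monotone_nat_of_le_succ fun n =>
      ((hep n).2.le_iff_mul_eq_right (hep (n + 1)).2).2 (hee n)
  · have := tendsto_projSup (fun n => (hep n).2) hee y
    rwa [hsup] at this
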